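/- Let $V(x_1,x_2)=\tfrac12(x_1^2+x_2^2)+x_1^2x_2-\tfrac13x_2^3$ be the Hénon–Heiles potential and $H(x,y)=\tfrac12|y|^2+V(x)$ on $\mathbb R^4$, with Hamiltonian flow $\dot x=\partial_yH$, $\dot y=-\partial_xH$. Let $v_1=(0,1)$, $v_2=(-\tfrac{\sqrt3}{2},-\tfrac12)$, $v_3=(\tfrac{\sqrt3}{2},-\tfrac12)$ be the saddle points of $V$, let $K_{1/6}$ be the closed triangular region with vertices $v_1,v_2,v_3$, let $S_{1/6}=\{(x,y): H(x,y)=\tfrac16,\ x\in K_{1/6}\}$, and let $p_i=(v_i,0)$, $i=1,2,3$, be the saddle-centers in $S_{1/6}$. At a regular point of $H$ let $X_0=\nabla H/|\nabla H|$, $X_1=j_1X_0$, $X_2=j_2X_0$ (the quaternion frame), where $j_1(a_1,a_2,b_1,b_2)=(b_2,-b_1,a_2,-a_1)$ and $j_2(a_1,a_2,b_1,b_2)=(a_2,-a_1,-b_2,b_1)$. A transverse linearized solution along a trajectory $w(t)$ is $\alpha(t)=\langle u,X_1(w)\rangle+i\langle u,X_2(w)\rangle$, where $u(t)$ is a solution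 of the linearized Hamiltonian flow along $w$ tangent to the energy surface; $\theta(t)$ denotes a continuous argument of a non-vanishing $\alpha(t)$. For a periodic orbit $P=(w,T)$ ($w$ non-constant and $T>0$ any period of $w$), let $I$ be the set of all values $(\theta(T)-\theta(0))/2\pi$; the index $\mu(P)$ is $2k+1$ if $I-\varepsilon\subset(k,k+1)$, and $2k$ if $k\in\mathrm{int}(I-\varepsilon)$, $k\in\mathbb Z$, for all sufficiently small $\varepsilon>0$. Then: (i) $S_{1/6}\setminus\{p_1,p_2,p_3\}$ is dynamically convex: every periodic orbit $P$ contained in it has (well-defined) index $\mu(P)\ge 3$. (ii) The quaternion frame $\{X_1,X_2\}$ is positive on $S_{1/6}\setminus\{p_1,p_2,p_3\}$: it is defined and symplectic there, i.e. $\nabla H\neq0$ and $\omega_0(X_1,X_2)=1$ with $\omega_0=dy_1\wedge dx_1+dy_2\wedge dx_2$, and along every trajectory in this set every continuous argument $\theta$ of a non-vanishing transverse linearized solution satisfies $\dot\theta(t)>0$ for all $t$. -/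

import Mathlib

open Set Filter Topology

noncomputable section

namespace HenonHeiles

/-- The plane `ℝ²` of positions. -/
abbrev R2 : Type := EuclideanSpace ℝ (Fin 2)

/-- Phase space `ℝ⁴` with coordinates `(x₁, x₂, y₁, y₂) = (w 0, w 1, w 2, w 3)`. -/
abbrev R4 : Type := EuclideanSpace ℝ (Fin 4)

/-- The standard symplectic form `ω₀ = dy₁ ∧ dx₁ + dy₂ ∧ dx₂`. -/
def omega0 (u v : R4) : ℝ :=
  (u 2 * v 0 - u 0 * v 2) + (u 3 * v 1 - u 1 * v 3)

/-- `j₁ (a₁, a₂, b₁, b₂) = (b₂, -b₁, a₂, -a₁)`. -/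
def j1 (v : R4) : R4 := !₂[v 3, -v 2, v 1, -v 0]

/-- `j₂ (a₁, a₂, b₁, b₂) = (a₂, -a₁, -b₂, b₁)`. -/
def j2 (v : R4) : R4 := !₂[v 1, -v 0, -v 3, v 2]

/-- `j₃ (a₁, a₂, b₁, b₂) = (b₁, b₂, -a₁, -a₂)`; the Hamiltonian vector field is `j₃ ∇H`. -/
def j3 (v : R4) : R4 := !₂[v 2, v 3, -v 0, -v 1]

/-! ### The quaternion frame and the linearized flow of a Hamiltonian -/

/-- The unit normal `X₀ = ∇H / |∇H|` to the level set of `H` (at a regular point). -/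
def X0 (H : R4 → ℝ) (w : R4) : R4 := ‖gradient H w‖⁻¹ • gradient H w

/-- The first vector of the transverse quaternion frame. -/
def X1 (H : R4 → ℝ) (w : R4) : R4 := j1 (X0 H w)

/-- The second vector of the transverse quaternion frame. -/
def X2 (H : R4 → ℝ) (w : R4) : R4 := j2 (X0 H w)

/-- The Hessian of `H` at `w`, as a linear map: the derivative of the gradient. -/
def hessian (H : R4 → ℝ) (w : R4) : R4 →L[ℝ] R4 := fderiv ℝ (gradient H) w

/-- `w` solves Hamilton's equations `ẇ = j₃ ∇H(w)` at all times in `J`. -/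
def IsTrajectoryOn (H : R4 → ℝ) (w : ℝ → R4) (J : Set ℝ) : Prop :=
  ∀ t ∈ J, HasDerivAt w (j3 (gradient H (w t))) t

/-- `u` is a linearized solution along `w` on `J`: it is tangent to the energy surface and
`u̇ = j₃ 𝓗(w) u`. -/
def IsLinearizedSolutionOn (H : R4 → ℝ) (w u : ℝ → R4) (J : Set ℝ) : Prop :=
  ∀ t ∈ J, inner ℝ (gradient H (w t)) (u t) = 0 ∧
    HasDerivAt u (j3 (hessian H (w t) (u t))) t

/-- The transverse part `α₁ + i α₂` of `u = α₁ X₁ + α₂ X₂ + α₃ X₃`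
(the frame `X₁, X₂, X₃` is orthonormal). -/
def transverse (H : R4 → ℝ) (w u : ℝ → R4) (t : ℝ) : ℂ :=
  ⟨inner ℝ (X1 H (w t)) (u t), inner ℝ (X2 H (w t)) (u t)⟩

/-- `θ` is a continuous argument on `J` of the nowhere vanishing curve `α`:
`α(t) ∈ ℝ⁺ e^{iθ(t)}`. -/
def IsContinuousArgumentOn (α : ℝ → ℂ) (θ : ℝ → ℝ) (J : Set ℝ) : Prop :=
  ContinuousOn θ J ∧
    ∀ t ∈ J, ∃ r : ℝ, 0 < r ∧ α t = (r : ℂ) * Complex.exp ((θ t : ℂ) * Complex.I)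

/-- The quaternion frame `{X₁, X₂}` of `H` is positive on `S`: on `S` it is a well-defined
symplectic frame, and every continuous argument `θ` of a non-vanishing transverse linearized
solution along any piece of trajectory in `S` is differentiable with `θ̇ > 0`.
(`deriv` is `0` where `θ` is not differentiable.) -/
def QuaternionFramePositive (H : R4 → ℝ) (S : Set R4) : Prop :=
  (∀ w ∈ S, gradient H w ≠ 0 ∧ omega0 (X1 H w) (X2 H w) = 1) ∧
  ∀ (a b : ℝ) (w u : ℝ → R4) (θ : ℝ → ℝ),
    (∀ t ∈ Ioo a b, w t ∈ S) →
    IsTrajectoryOn H w (Ioo a b) →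
    IsLinearizedSolutionOn H w u (Ioo a b) →
    IsContinuousArgumentOn (transverse H w u) θ (Ioo a b) →
    ∀ t ∈ Ioo a b, 0 < deriv θ t

/-! ### Periodic orbits and their index -/

/-- `P = (w, T)` is a (non-constant) periodic orbit; `T > 0` is a period,
not necessarily the least one. -/
def IsPeriodicOrbit (H : R4 → ℝ) (w : ℝ → R4) (T : ℝ) : Prop :=
  0 < T ∧ IsTrajectoryOn H w univ ∧ Function.Periodic w T ∧ ∃ t, w t ≠ w 0

/-- The set `I` of the numbers `(θ(T) - θ(0)) / 2π`, over all the non-vanishing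
transverse linearized solutions along `(w, T)`. -/
def rotationSet (H : R4 → ℝ) (w : ℝ → R4) (T : ℝ) : Set ℝ :=
  {r | ∃ (u : ℝ → R4) (θ : ℝ → ℝ),
    IsLinearizedSolutionOn H w u univ ∧
    IsContinuousArgumentOn (transverse H w u) θ univ ∧
    r = (θ T - θ 0) / (2 * Real.pi)}

/-- `μ` is the (generalized Conley–Zehnder) index of `(w, T)`: for all small `ε > 0`, with
`I_ε = I - ε`, either `μ = 2k + 1` and `I_ε ⊆ (k, k + 1)`, or `μ = 2k` and `k ∈ int I_ε`. -/
def HasIndex (H : R4 → ℝ) (w : ℝ → R4) (T : ℝ) (μ : ℤ) : Prop :=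
  ∀ᶠ ε in 𝓝[>] (0 : ℝ), ∃ k : ℤ,
    (μ = 2 * k + 1 ∧ (fun r => r - ε) '' rotationSet H w T ⊆ Ioo (k : ℝ) (k + 1)) ∨
    (μ = 2 * k ∧ (k : ℝ) ∈ interior ((fun r => r - ε) '' rotationSet H w T))

/-- `S` is dynamically convex: the index of every periodic orbit in `S` is (defined and)
at least `3`. -/
def DynamicallyConvex (H : R4 → ℝ) (S : Set R4) : Prop :=
  ∀ (w : ℝ → R4) (T : ℝ), IsPeriodicOrbit H w T → (∀ t, w t ∈ S) →
    (∃! μ : ℤ, HasIndex H w T μ) ∧ ∀ μ : ℤ, HasIndex H w T μ → 3 ≤ μ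

/-! ### The Hénon–Heiles system at the critical level `1/6` -/

/-- The Hénon–Heiles potential. -/
def V (x : R2) : ℝ :=
  (x 0 ^ 2 + x 1 ^ 2) / 2 + x 0 ^ 2 * x 1 - x 1 ^ 3 / 3

/-- The projection `(x, y) ↦ x`. -/
def proj (w : R4) : R2 := !₂[w 0, w 1]

/-- The Hénon–Heiles Hamiltonian `H = |y|²/2 + V(x)`. -/
def H (w : R4) : ℝ := (w 2 ^ 2 + w 3 ^ 2) / 2 + V (proj w)

/-- The first saddle point of the potential. -/
def v1 : R2 := !₂[0, 1]
/-- The second saddle point. -/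
def v2 : R2 := !₂[-(Real.sqrt 3) / 2, -1 / 2]
/-- The third saddle point. -/
def v3 : R2 := !₂[Real.sqrt 3 / 2, -1 / 2]

/-- The inclusion `x ↦ (x, 0)`. -/
def lift (x : R2) : R4 := !₂[x 0, x 1, 0, 0]

/-- `K_{1/6}`: the closed region bounded by the triangle with vertices `v₁, v₂, v₃`. -/
def K : Set R2 := convexHull ℝ {v1, v2, v3}

/-- `S_{1/6}`: the part of the energy surface `H = 1/6` that projects to `K_{1/6}`. -/
def S : Set R4 := {w | H w = 1 / 6 ∧ proj w ∈ K}

/-- The three saddle-centers `p₁, p₂, p₃`. -/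
def saddleCenters : Set R4 := {lift v1, lift v2, lift v3}

end HenonHeiles

end

noncomputable section

namespace HenonHeiles

/-! Write a point of phase space as (x, y) and g = -∇V. At the critical level the cubic 1/6 - V
splits into three affine factors, the sides of the triangle (`energy_eq`). This yields the convexity
inequality |y|² V''(ξ, ξ) + ⟨g, ξ⟩² > 0 for y ≠ 0 and ξ ≠ 0 (`convex_pos`). At points with y = 0
other than the saddle-centers, the potential is constant along the side, and the gradient does not
vanish (`brake_point`). Hence the Hessian of H is nonnegative on the tangent space of the energy
surface and positive on the flow direction. The angular speed of a transverse solution is, up to a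
positive factor, the sum of these two contributions (`rotation_identity`), so the frame is positive.

For dynamical convexity, the rotation numbers of a periodic orbit fill a compact interval of length
less than 1 (`rotationSet_eq_Icc`). The index is then at least 3 as soon as every rotation number
exceeds 1 (`index_of_Icc`), that is, as soon as every transverse solution turns by more than 2π in a
period (`RotatingSolution.two_pi_lt`).

This is a second variation argument. The flow vector (y, g) and a linearized solution u span a
Lagrangian plane, which is the graph of a symmetric form P over configuration space whenever `jac`,
the determinant of y and the x-part of u, is nonzero. Here P y = g and P' = -V'' - P². For the
three-dimensional family of fields ξ = (c₀, c₁) + c₂ x, the quantity ⟨Pξ, ξ⟩ - 2c₂⟨y, ξ⟩ is strictly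
decreasing by convexity (`riccati_deriv_neg`). One linear condition on c carries it across one
simple zero of `jac`, and another makes its values at the two ends of a period agree. Three
parameters satisfy both conditions with c ≠ 0, so `jac` has more than one simple zero in a period.

An angle relative to the vertical direction (`relAngle`) crosses multiples of π only upwards and
does so at zeros of `jac`; a turn of at most 2π would leave room for at most one simple zero.
Instants with y = 0, where `jac` vanishes for trivial reasons, are excluded separately in
`RotatingSolution.no_brake`. -/

/-- The gradient of `H`. -/
def gradH (w : R4) : R4 :=
  !₂[w 0 + 2 * w 0 * w 1, w 1 + w 0 ^ 2 - w 1 ^ 2, w 2, w 3]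

theorem H_eq (w : R4) : H w = (w 2 ^ 2 + w 3 ^ 2) / 2 + (w 0 ^ 2 + w 1 ^ 2) / 2
    + w 0 ^ 2 * w 1 - w 1 ^ 3 / 3 := by
  simp [H, V, proj]; ring

theorem hasFDerivAt_coord (i : Fin 4) (w : R4) :
    HasFDerivAt (fun w : R4 => w i) (EuclideanSpace.proj i : R4 →L[ℝ] ℝ) w :=
  (EuclideanSpace.proj (𝕜 := ℝ) i : R4 →L[ℝ] ℝ).hasFDerivAt

theorem hasGradientAt_H (w : R4) : HasGradientAt H (gradH w) w := by
  rw [hasGradientAt_iff_hasFDerivAt]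
  have h0 := hasFDerivAt_coord 0 w
  have h1 := hasFDerivAt_coord 1 w
  have h2 := hasFDerivAt_coord 2 w
  have h3 := hasFDerivAt_coord 3 w
  have e : H = fun w : R4 => (w 2 ^ 2 + w 3 ^ 2) * (1 / 2) + (w 0 ^ 2 + w 1 ^ 2) * (1 / 2)
    + w 0 ^ 2 * w 1 - w 1 ^ 3 * (1 / 3) := by
    funext w; rw [H_eq]; ring
  rw [e]
  refine (((((h2.pow 2).add (h3.pow 2)).mul_const (1 / 2)).add
    (((h0.pow 2).add (h1.pow 2)).mul_const (1 / 2))).add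
    ((h0.pow 2).mul h1)).sub ((h1.pow 3).mul_const (1 / 3)) |>.congr_fderiv ?_
  ext v
  simp [gradH, PiLp.inner_apply, Fin.sum_univ_four]
  ring

theorem gradient_H : gradient H = gradH := by
  funext w; exact (hasGradientAt_H w).gradient

theorem inner_R4 (u v : R4) : inner ℝ u v = u 0 * v 0 + u 1 * v 1 + u 2 * v 2 + u 3 * v 3 := by
  simp [PiLp.inner_apply, Fin.sum_univ_four]; ring

theorem hasDerivAt_R4 {w : ℝ → R4} {w' : R4} {t : ℝ} :
    HasDerivAt w w' t ↔ ∀ i, HasDerivAt (fun s => w s i) (w' i) t := by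
  refine ⟨fun h i => (hasFDerivAt_coord i (w t)).comp_hasDerivAt t h, fun h => ?_⟩
  exact (EuclideanSpace.equiv (Fin 4) ℝ).symm.hasFDerivAt.comp_hasDerivAt t (hasDerivAt_pi.2 h)

/-- The Hessian of `H`. -/
theorem hessian_H (w v : R4) : hessian H w v =
    !₂[(1 + 2 * w 1) * v 0 + 2 * w 0 * v 1, 2 * w 0 * v 0 + (1 - 2 * w 1) * v 1, v 2, v 3] := by
  have hd : Differentiable ℝ gradH := by
    rw [differentiable_euclidean]
    intro i
    fin_cases i <;> simp [gradH] <;> fun_prop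
  have hl : HasDerivAt (fun s : ℝ => gradH (w + s • v)) (fderiv ℝ gradH w v) 0 := by
    have h1 : HasDerivAt (fun s : ℝ => w + s • v) v 0 := by
      simpa using ((hasDerivAt_id (0 : ℝ)).smul_const v).const_add w
    have h2 : HasFDerivAt gradH (fderiv ℝ gradH w) (w + (0 : ℝ) • v) := by
      simpa using (hd w).hasFDerivAt
    exact h2.comp_hasDerivAt (0 : ℝ) h1
  rw [hessian, gradient_H]
  refine hl.unique (hasDerivAt_R4.2 fun i => ?_)
  have c : ∀ i, HasDerivAt (fun s : ℝ => (w + s • v) i) (v i) 0 := fun i => by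
    simpa using ((hasDerivAt_id (0 : ℝ)).mul_const (v i)).const_add (w i)
  have h0 := c 0
  have h1 := c 1
  fin_cases i
  · refine (h0.add ((h0.const_mul 2).mul h1)).congr_deriv ?_
    simp; ring
  · refine ((h1.add (h0.pow 2)).sub (h1.pow 2)).congr_deriv ?_
    simp; ring
  · exact c 2
  · exact c 3

/-! ### Coordinates -/

/-- The velocity of the momentum: first component of `-∇V`. -/
def g1 (w : R4) : ℝ := -(w 0 + 2 * w 0 * w 1)
/-- Second component of `-∇V`. -/
def g2 (w : R4) : ℝ := -(w 1 + w 0 ^ 2 - w 1 ^ 2)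

/-- The quadratic form `V''`. -/
def hessV (w : R4) (a b : ℝ) : ℝ := (1 + 2 * w 1) * a ^ 2 + 4 * w 0 * a * b + (1 - 2 * w 1) * b ^ 2

theorem trajectory_iff {w : ℝ → R4} {I : Set ℝ} : IsTrajectoryOn H w I ↔ ∀ t ∈ I,
    HasDerivAt (fun s => w s 0) (w t 2) t ∧ HasDerivAt (fun s => w s 1) (w t 3) t ∧
    HasDerivAt (fun s => w s 2) (g1 (w t)) t ∧ HasDerivAt (fun s => w s 3) (g2 (w t)) t := by
  unfold IsTrajectoryOn
  simp only [hasDerivAt_R4, gradient_H, Fin.forall_fin_succ]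
  simp [j3, gradH, g1, g2]

theorem inner_grad (w u : R4) : inner ℝ (gradient H w) u =
    w 2 * u 2 + w 3 * u 3 - (g1 w * u 0 + g2 w * u 1) := by
  rw [gradient_H, inner_R4]; simp [gradH, g1, g2]; ring

theorem linearized_iff {w u : ℝ → R4} {I : Set ℝ} : IsLinearizedSolutionOn H w u I ↔ ∀ t ∈ I,
    (w t 2 * u t 2 + w t 3 * u t 3 = g1 (w t) * u t 0 + g2 (w t) * u t 1) ∧
    HasDerivAt (fun s => u s 0) (u t 2) t ∧ HasDerivAt (fun s => u s 1) (u t 3) t ∧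
    HasDerivAt (fun s => u s 2)
      (-((1 + 2 * w t 1) * u t 0 + 2 * w t 0 * u t 1)) t ∧
    HasDerivAt (fun s => u s 3)
      (-(2 * w t 0 * u t 0 + (1 - 2 * w t 1) * u t 1)) t := by
  unfold IsLinearizedSolutionOn
  simp only [hasDerivAt_R4, hessian_H, Fin.forall_fin_succ, inner_grad, sub_eq_zero]
  simp [j3]

/-! ### The transverse part without normalization -/

/-- `|∇H|²`. -/
def nsq (w : R4) : ℝ := g1 w ^ 2 + g2 w ^ 2 + w 2 ^ 2 + w 3 ^ 2

/-- The transverse part of `u` in the frame `|∇H| X₁, |∇H| X₂`, first component. -/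
def tr1 (w u : R4) : ℝ := -(w 2 * u 1 - w 3 * u 0) + (g1 w * u 3 - g2 w * u 2)
/-- The transverse part of `u` in the frame `|∇H| X₁, |∇H| X₂`, second component. -/
def tr2 (w u : R4) : ℝ := (g1 w * u 1 - g2 w * u 0) + (w 2 * u 3 - w 3 * u 2)

/-- The transverse part of `u` in the frame `|∇H| X₁, |∇H| X₂`. -/
def tr (w u : R4) : ℂ := ⟨tr1 w u, tr2 w u⟩

theorem norm_gradient_sq (w : R4) : ‖gradient H w‖ ^ 2 = nsq w := by
  rw [gradient_H, ← real_inner_self_eq_norm_sq, inner_R4]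
  simp [gradH, nsq, g1, g2]; ring

theorem norm_gradient_pos {w : R4} (h : 0 < nsq w) : 0 < ‖gradient H w‖ := by
  rw [← norm_gradient_sq] at h
  exact lt_of_le_of_ne (norm_nonneg _) fun e => by simp [← e] at h

theorem transverse_eq (w u : ℝ → R4) (t : ℝ) :
    transverse H w u t = ((‖gradient H (w t)‖⁻¹ : ℝ) : ℂ) * tr (w t) (u t) := by
  apply Complex.ext
  · rw [Complex.re_ofReal_mul]
    simp only [transverse, X1, X0, tr, tr1, j1, inner_R4]
    rw [gradient_H]; simp [gradH, g1, g2]; ring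
  · rw [Complex.im_ofReal_mul]
    simp only [transverse, X2, X0, tr, tr2, j2, inner_R4]
    rw [gradient_H]; simp [gradH, g1, g2]; ring

/-- Dividing by |∇H| does not change arguments, so `tr`, which is polynomial in w and u, may replace
`transverse` throughout. -/
theorem isContinuousArgumentOn_transverse_iff {w u : ℝ → R4} {θ : ℝ → ℝ} {I : Set ℝ}
    (hw : ∀ t ∈ I, 0 < nsq (w t)) :
    IsContinuousArgumentOn (transverse H w u) θ I ↔
      IsContinuousArgumentOn (fun t => tr (w t) (u t)) θ I := by
  unfold IsContinuousArgumentOn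
  refine and_congr_right fun _ => forall₂_congr fun t ht => ?_
  have hn := norm_gradient_pos (hw t ht)
  have hn' : ((‖gradient H (w t)‖ : ℝ) : ℂ) ≠ 0 := by exact_mod_cast hn.ne'
  constructor
  · rintro ⟨r, hr, h⟩
    refine ⟨‖gradient H (w t)‖ * r, mul_pos hn hr, ?_⟩
    rw [transverse_eq] at h
    push_cast
    rw [mul_assoc, ← h, Complex.ofReal_inv, mul_inv_cancel_left₀ hn']
  · rintro ⟨r, hr, h⟩
    refine ⟨‖gradient H (w t)‖⁻¹ * r, mul_pos (inv_pos.2 hn) hr, ?_⟩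
    rw [transverse_eq]
    push_cast
    rw [show tr (w t) (u t) = _ from h, mul_assoc]

theorem omega0_frame {w : R4} (h : 0 < nsq w) : omega0 (X1 H w) (X2 H w) = 1 := by
  have hn := norm_gradient_pos h
  have h2 := norm_gradient_sq w
  have : omega0 (X1 H w) (X2 H w) = ‖gradient H w‖⁻¹ ^ 2 * nsq w := by
    simp only [omega0, X1, X2, X0, j1, j2]
    rw [gradient_H]; simp [gradH, nsq, g1, g2]; ring
  rw [this, ← h2]; field_simp

/-! ### The triangle -/

/-- The first affine function cutting out `K`. -/
def l1 (w : R4) : ℝ := 1 + 2 * w 1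
/-- The second affine function cutting out `K`. -/
def l2 (w : R4) : ℝ := 1 - w 1 - √3 * w 0
/-- The third affine function cutting out `K`. -/
def l3 (w : R4) : ℝ := 1 - w 1 + √3 * w 0

theorem sq_sqrt3 : (√3 : ℝ) ^ 2 = 3 := Real.sq_sqrt (by norm_num)

theorem l_nonneg_of_mem_K {w : R4} (h : proj w ∈ K) : 0 ≤ l1 w ∧ 0 ≤ l2 w ∧ 0 ≤ l3 w := by
  have hc : Convex ℝ {x : R2 | 0 ≤ 1 + 2 * x 1 ∧ 0 ≤ 1 - x 1 - √3 * x 0 ∧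
      0 ≤ 1 - x 1 + √3 * x 0} := by
    intro x hx y hy a b ha hb hab
    simp only [mem_ofPred_eq, PiLp.add_apply, PiLp.smul_apply, smul_eq_mul] at hx hy ⊢
    obtain ⟨x1, x2, x3⟩ := hx
    obtain ⟨y1, y2, y3⟩ := hy
    refine ⟨?_, ?_, ?_⟩
    · nlinarith [mul_nonneg ha x1, mul_nonneg hb y1]
    · nlinarith [mul_nonneg ha x2, mul_nonneg hb y2]
    · nlinarith [mul_nonneg ha x3, mul_nonneg hb y3]
  have hs : ({v1, v2, v3} : Set R2) ⊆ {x : R2 | 0 ≤ 1 + 2 * x 1 ∧ 0 ≤ 1 - x 1 - √3 * x 0 ∧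
      0 ≤ 1 - x 1 + √3 * x 0} := by
    have h3 := sq_sqrt3
    rintro x (rfl | rfl | rfl) <;> simp [v1, v2, v3] <;>
      (try constructor) <;> (try constructor) <;> nlinarith
  have := convexHull_min hs hc h
  simpa [proj, l1, l2, l3] using this

/-- The critical level curve of V is the union of the three lines bounding the triangle: 6(1/6 - V)
= l₁l₂l₃. -/
theorem energy_eq {w : R4} (h : H w = 1 / 6) :
    3 * (w 2 ^ 2 + w 3 ^ 2) = l1 w * l2 w * l3 w := by
  rw [H_eq] at h
  simp only [l1, l2, l3]
  linear_combination 6 * h + (1 + 2 * w 1) * w 0 ^ 2 * sq_sqrt3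

/-! ### Convexity -/

/-- With Q = l₁l₂l₃ = 6(1/6 - V), the left side is Q'² - 2QQ'' in the direction (a, b). Let dᵢ be
the derivative of lᵢ in that direction, and put A = d₁l₂l₃, B = d₂l₁l₃, C = d₃l₁l₂. Then Q' = A + B
+ C and QQ'' = 2(AB + AC + BC). -/
theorem energy_identity {w : R4} (h : H w = 1 / 6) (a b : ℝ) :
    36 * ((w 2 ^ 2 + w 3 ^ 2) * hessV w a b + (g1 w * a + g2 w * b) ^ 2) =
      (2 * b * l2 w * l3 w) ^ 2 + ((-b - √3 * a) * l1 w * l3 w) ^ 2 +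
      ((-b + √3 * a) * l1 w * l2 w) ^ 2 -
      2 * (2 * b * l2 w * l3 w) * ((-b - √3 * a) * l1 w * l3 w) -
      2 * (2 * b * l2 w * l3 w) * ((-b + √3 * a) * l1 w * l2 w) -
      2 * ((-b - √3 * a) * l1 w * l3 w) * ((-b + √3 * a) * l1 w * l2 w) := by
  have h3 := sq_sqrt3
  have e1 : hessV w a b = -(1 / 3) * (2 * b * (-b - √3 * a) * l3 w +
      2 * b * (-b + √3 * a) * l2 w + (-b - √3 * a) * (-b + √3 * a) * l1 w) := by
    simp only [hessV, l1, l2, l3]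
    linear_combination (-(4 * a * b * w 0) / 3 - a ^ 2 * (1 + 2 * w 1) / 3) * h3
  have e2 : g1 w * a + g2 w * b = (2 * b * l2 w * l3 w + (-b - √3 * a) * l1 w * l3 w +
      (-b + √3 * a) * l1 w * l2 w) / 6 := by
    simp only [g1, g2, l1, l2, l3]
    linear_combination (w 0 ^ 2 * b / 3 + a * w 0 * (1 + 2 * w 1) / 3) * h3
  rw [e1, e2]
  linear_combination (-4) * (2 * b * (-b - √3 * a) * l3 w +
      2 * b * (-b + √3 * a) * l2 w + (-b - √3 * a) * (-b + √3 * a) * l1 w) * energy_eq h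

/-- As the dᵢ sum to zero and are not all zero, one of them has a strict sign and the other two have
the opposite weak sign. Up to a global sign, the form is then (x - y)² + z² - 2z(x + y) with x, y ≥
0 > z. -/
theorem discr_pos {p q r d1 d2 d3 : ℝ} (hp : 0 < p) (hq : 0 < q) (hr : 0 < r)
    (hd : d1 + d2 + d3 = 0) (hne : d1 ≠ 0 ∨ d2 ≠ 0) :
    0 < (d1 * q * r) ^ 2 + (d2 * p * r) ^ 2 + (d3 * p * q) ^ 2 -
      2 * (d1 * q * r) * (d2 * p * r) - 2 * (d1 * q * r) * (d3 * p * q) -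
      2 * (d2 * p * r) * (d3 * p * q) := by
  have key : ∀ x y z : ℝ, 0 ≤ x → 0 ≤ y → z < 0 →
      0 < x ^ 2 + y ^ 2 + z ^ 2 - 2 * x * y - 2 * x * z - 2 * y * z := fun x y z hx hy hz => by
    nlinarith [sq_nonneg (x - y), mul_nonneg hx (neg_nonneg.2 hz.le),
      mul_nonneg hy (neg_nonneg.2 hz.le), mul_pos (neg_pos.2 hz) (neg_pos.2 hz)]
  have hqr := mul_pos hq hr
  have hpr := mul_pos hp hr
  have hpq := mul_pos hp hq
  simp only [mul_assoc] at *
  have n1 : ∀ {d m : ℝ}, 0 ≤ d → 0 < m → 0 ≤ d * m := fun h h' => mul_nonneg h h'.le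
  have n2 : ∀ {d m : ℝ}, d < 0 → 0 < m → d * m < 0 := fun h h' => mul_neg_of_neg_of_pos h h'
  have n3 : ∀ {d m : ℝ}, d ≤ 0 → 0 < m → 0 ≤ -(d * m) := fun h h' => by nlinarith
  have n4 : ∀ {d m : ℝ}, 0 < d → 0 < m → -(d * m) < 0 := fun h h' => by nlinarith
  rcases le_or_gt 0 d1 with s1 | s1 <;> rcases le_or_gt 0 d2 with s2 | s2 <;>
    rcases le_or_gt 0 d3 with s3 | s3
  · exfalso; rcases hne with h | h <;> apply h <;> linarith
  · linarith [key _ _ _ (n1 s1 hqr) (n1 s2 hpr) (n2 s3 hpq)]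
  · linarith [key _ _ _ (n1 s1 hqr) (n1 s3 hpq) (n2 s2 hpr)]
  · have : 0 < d1 := by linarith
    linarith [key _ _ _ (n3 s2.le hpr) (n3 s3.le hpq) (n4 this hqr)]
  · linarith [key _ _ _ (n1 s2 hpr) (n1 s3 hpq) (n2 s1 hqr)]
  · have : 0 < d2 := by linarith
    linarith [key _ _ _ (n3 s1.le hqr) (n3 s3.le hpq) (n4 this hpr)]
  · have : 0 < d3 := by linarith
    linarith [key _ _ _ (n3 s1.le hqr) (n3 s2.le hpr) (n4 this hpq)]
  · linarith

/-- Strict convexity of the energy surface at points with nonzero momentum. -/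
theorem convex_pos {w : R4} (hw : w ∈ S) (hy : 0 < w 2 ^ 2 + w 3 ^ 2) {a b : ℝ}
    (hab : a ≠ 0 ∨ b ≠ 0) :
    0 < (w 2 ^ 2 + w 3 ^ 2) * hessV w a b + (g1 w * a + g2 w * b) ^ 2 := by
  obtain ⟨hH, hK⟩ := hw
  obtain ⟨p1, p2, p3⟩ := l_nonneg_of_mem_K hK
  have hP : 0 < l1 w * l2 w * l3 w := by rw [← energy_eq hH]; linarith
  have q1 : 0 < l1 w := p1.lt_of_ne (by rintro e; simp [← e] at hP)
  have q2 : 0 < l2 w := p2.lt_of_ne (by rintro e; simp [← e] at hP)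
  have q3 : 0 < l3 w := p3.lt_of_ne (by rintro e; simp [← e] at hP)
  have := discr_pos q1 q2 q3 (d1 := 2 * b) (d2 := -b - √3 * a) (d3 := -b + √3 * a) (by ring) (by
    by_cases hb : b = 0
    · right
      have ha : a ≠ 0 := by tauto
      simp [hb, ha]
    · left; simpa using hb)
  rw [← energy_identity hH] at this
  linarith

theorem convex_nonneg {w : R4} (hw : w ∈ S) (hy : 0 < w 2 ^ 2 + w 3 ^ 2) (a b : ℝ) :
    0 ≤ (w 2 ^ 2 + w 3 ^ 2) * hessV w a b + (g1 w * a + g2 w * b) ^ 2 := by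
  by_cases h : a ≠ 0 ∨ b ≠ 0
  · exact (convex_pos hw hy h).le
  · push Not at h
    simp [h.1, h.2, hessV]

/-- On the boundary of the triangle away from the vertices, the gradient does not vanish and
the potential is flat in the tangential direction. -/
theorem brake_point {w : R4} (hw : w ∈ S \ saddleCenters) (h2 : w 2 = 0) (h3 : w 3 = 0) :
    0 < g1 w ^ 2 + g2 w ^ 2 ∧ ∀ a b : ℝ, g1 w * a + g2 w * b = 0 → hessV w a b = 0 := by
  obtain ⟨⟨hH, hK⟩, hns⟩ := hw
  obtain ⟨p1, p2, p3⟩ := l_nonneg_of_mem_K hK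
  have hs := sq_sqrt3
  have hs0 : √3 ≠ 0 := by positivity
  have e1 : ∀ a b, hessV w a b = -(1 / 3) * (2 * b * (-b - √3 * a) * l3 w +
      2 * b * (-b + √3 * a) * l2 w + (-b - √3 * a) * (-b + √3 * a) * l1 w) := fun a b => by
    simp only [hessV, l1, l2, l3]
    linear_combination (-(4 * a * b * w 0) / 3 - a ^ 2 * (1 + 2 * w 1) / 3) * hs
  have e2 : ∀ a b, g1 w * a + g2 w * b = (2 * b * l2 w * l3 w + (-b - √3 * a) * l1 w * l3 w +
      (-b + √3 * a) * l1 w * l2 w) / 6 := fun a b => by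
    simp only [g1, g2, l1, l2, l3]
    linear_combination (w 0 ^ 2 * b / 3 + a * w 0 * (1 + 2 * w 1) / 3) * hs
  have vert : ∀ v : R2, w 0 = v 0 → w 1 = v 1 → w = lift v := fun v k0 k1 => by
    ext i; fin_cases i <;> simp [lift, *]
  have n12 : ¬ (l1 w = 0 ∧ l2 w = 0) := fun ⟨a, b⟩ => hns <| by
    rw [l1] at a; rw [l2] at b
    refine Or.inr (Or.inr (vert _ ?_ ?_)) <;> simp [v3]
    · have : w 1 = -1 / 2 := by linarith
      rw [this] at b
      have : √3 * (w 0 - √3 / 2) = 0 := by nlinarith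
      have := (mul_eq_zero.1 this).resolve_left hs0
      linarith
    · linarith
  have n13 : ¬ (l1 w = 0 ∧ l3 w = 0) := fun ⟨a, b⟩ => hns <| by
    rw [l1] at a; rw [l3] at b
    refine Or.inr (Or.inl (vert _ ?_ ?_)) <;> simp [v2]
    · have : w 1 = -1 / 2 := by linarith
      rw [this] at b
      have : √3 * (w 0 + √3 / 2) = 0 := by nlinarith
      have := (mul_eq_zero.1 this).resolve_left hs0
      linarith
    · linarith
  have n23 : ¬ (l2 w = 0 ∧ l3 w = 0) := fun ⟨a, b⟩ => hns <| by
    rw [l2] at a; rw [l3] at b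
    refine Or.inl (vert _ ?_ ?_) <;> simp [v1]
    · have : √3 * w 0 = 0 := by linarith
      exact (mul_eq_zero.1 this).resolve_left hs0
    · linarith
  have hP : l1 w * l2 w * l3 w = 0 := by rw [← energy_eq hH, h2, h3]; ring
  have fin : (∃ a b, g1 w * a + g2 w * b ≠ 0) → 0 < g1 w ^ 2 + g2 w ^ 2 := by
    rintro ⟨a, b, h⟩
    by_contra hc
    have k1 : g1 w = 0 := by nlinarith [sq_nonneg (g1 w), sq_nonneg (g2 w)]
    have k2 : g2 w = 0 := by nlinarith [sq_nonneg (g1 w), sq_nonneg (g2 w)]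
    simp [k1, k2] at h
  rcases mul_eq_zero.1 hP with hP | z
  · rcases mul_eq_zero.1 hP with z | z
    · have k2 : l2 w ≠ 0 := fun h => n12 ⟨z, h⟩
      have k3 : l3 w ≠ 0 := fun h => n13 ⟨z, h⟩
      -- The direction (0, 1) is transverse to all three sides, so it detects ∇V ≠ 0 in each case. A
      -- direction orthogonal to ∇V runs along the side, on which V is constant.
      refine ⟨fin ⟨0, 1, ?_⟩, fun a b h => ?_⟩
      · rw [e2, z]; simp [k2, k3]
      · rw [e2, z] at h
        have hb : b = 0 := by simpa [k2, k3] using h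
        rw [e1, z, hb]; ring
    · have k1 : l1 w ≠ 0 := fun h => n12 ⟨h, z⟩
      have k3 : l3 w ≠ 0 := fun h => n23 ⟨z, h⟩
      refine ⟨fin ⟨0, 1, ?_⟩, fun a b h => ?_⟩
      · rw [e2, z]; simp [k1, k3]
      · rw [e2, z] at h
        have hb : -b - √3 * a = 0 := by simpa [k1, k3] using h
        rw [e1, z, hb]; ring
  · have k1 : l1 w ≠ 0 := fun h => n13 ⟨h, z⟩
    have k2 : l2 w ≠ 0 := fun h => n23 ⟨h, z⟩
    refine ⟨fin ⟨0, 1, ?_⟩, fun a b h => ?_⟩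
    · rw [e2, z]; simp [k1, k2]
    · rw [e2, z] at h
      have hb : -b + √3 * a = 0 := by simpa [k1, k2] using h
      rw [e1, z, hb]; ring

theorem momentum_cases (w : R4) : (w 2 = 0 ∧ w 3 = 0) ∨ 0 < w 2 ^ 2 + w 3 ^ 2 := by
  by_cases h : 0 < w 2 ^ 2 + w 3 ^ 2
  · exact Or.inr h
  · left
    constructor <;> nlinarith [sq_nonneg (w 2), sq_nonneg (w 3)]

theorem nsq_pos {w : R4} (hw : w ∈ S \ saddleCenters) : 0 < nsq w := by
  rcases momentum_cases w with ⟨h2, h3⟩ | h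
  · have := (brake_point hw h2 h3).1
    rw [nsq, h2, h3]; linarith
  · rw [nsq]; nlinarith [sq_nonneg (g1 w), sq_nonneg (g2 w)]

/-- By tangency |y|²(c² + d²) is ⟨g, (a, b)⟩² plus the square of a determinant, so |y|² times the
Hessian dominates the convexity expression. -/
theorem hess_tangent_nonneg {w : R4} (hw : w ∈ S \ saddleCenters) {a b c d : ℝ}
    (ht : w 2 * c + w 3 * d = g1 w * a + g2 w * b) : 0 ≤ hessV w a b + c ^ 2 + d ^ 2 := by
  rcases momentum_cases w with ⟨h2, h3⟩ | h
  · rw [(brake_point hw h2 h3).2 a b (by rw [← ht, h2, h3]; ring)]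
    positivity
  · have h1 := convex_nonneg hw.1 h a b
    rw [← ht] at h1
    refine nonneg_of_mul_nonneg_right ?_ h
    nlinarith [sq_nonneg (w 2 * d - w 3 * c)]

theorem hess_flow_pos {w : R4} (hw : w ∈ S \ saddleCenters) :
    0 < hessV w (w 2) (w 3) + g1 w ^ 2 + g2 w ^ 2 := by
  rcases momentum_cases w with ⟨h2, h3⟩ | h
  · have := (brake_point hw h2 h3).1
    rw [h2, h3, hessV]; linarith
  · have h1 := convex_pos hw.1 h (a := w 2) (b := w 3) (by
      by_contra hc; push Not at hc; simp [hc.1, hc.2] at h)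
    refine (mul_pos_iff_of_pos_left h).1 ?_
    nlinarith [sq_nonneg (g1 w * w 3 - g2 w * w 2)]

/-! ### The transverse equation -/

/-- The derivative of `tr1` along the linearized flow. -/
def dtr1 (w u : R4) : ℝ :=
  -(g1 w * u 1 - g2 w * u 0 + (w 2 * u 3 - w 3 * u 2)) +
  (-((1 + 2 * w 1) * w 2 + 2 * w 0 * w 3) * u 3 + (2 * w 0 * w 2 + (1 - 2 * w 1) * w 3) * u 2
  - g1 w * (2 * w 0 * u 0 + (1 - 2 * w 1) * u 1)
  + g2 w * ((1 + 2 * w 1) * u 0 + 2 * w 0 * u 1))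

/-- The derivative of `tr2` along the linearized flow. -/
def dtr2 (w u : R4) : ℝ :=
  -((1 + 2 * w 1) * w 2 + 2 * w 0 * w 3) * u 1 + (2 * w 0 * w 2 + (1 - 2 * w 1) * w 3) * u 0
  + 2 * (g1 w * u 3 - g2 w * u 2)
  - w 2 * (2 * w 0 * u 0 + (1 - 2 * w 1) * u 1)
  + w 3 * ((1 + 2 * w 1) * u 0 + 2 * w 0 * u 1)

theorem hasDerivAt_g1 {w : ℝ → R4} {I : Set ℝ} (hw : IsTrajectoryOn H w I) {t : ℝ} (ht : t ∈ I) :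
    HasDerivAt (fun s => g1 (w s)) (-((1 + 2 * w t 1) * w t 2 + 2 * w t 0 * w t 3)) t := by
  obtain ⟨w0, w1, -, -⟩ := trajectory_iff.1 hw t ht
  refine ((w0.add ((w0.const_mul 2).mul w1)).neg).congr_deriv ?_
  ring

theorem hasDerivAt_g2 {w : ℝ → R4} {I : Set ℝ} (hw : IsTrajectoryOn H w I) {t : ℝ} (ht : t ∈ I) :
    HasDerivAt (fun s => g2 (w s)) (-(2 * w t 0 * w t 2 + (1 - 2 * w t 1) * w t 3)) t := by
  obtain ⟨w0, w1, -, -⟩ := trajectory_iff.1 hw t ht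
  refine (((w1.add (w0.pow 2)).sub (w1.pow 2)).neg).congr_deriv ?_
  simp; ring

theorem hasDerivAt_tr {w u : ℝ → R4} {I : Set ℝ} (hw : IsTrajectoryOn H w I)
    (hu : IsLinearizedSolutionOn H w u I) {t : ℝ} (ht : t ∈ I) :
    HasDerivAt (fun s => tr (w s) (u s)) ⟨dtr1 (w t) (u t), dtr2 (w t) (u t)⟩ t := by
  obtain ⟨-, -, w2, w3⟩ := trajectory_iff.1 hw t ht
  obtain ⟨-, u0, u1, u2, u3⟩ := linearized_iff.1 hu t ht
  have G1 := hasDerivAt_g1 hw ht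
  have G2 := hasDerivAt_g2 hw ht
  have h1 : HasDerivAt (fun s => tr1 (w s) (u s)) (dtr1 (w t) (u t)) t := by
    refine ((((w2.mul u1).sub (w3.mul u0)).neg).add ((G1.mul u3).sub (G2.mul u2))).congr_deriv ?_
    simp only [dtr1]; ring
  have h2 : HasDerivAt (fun s => tr2 (w s) (u s)) (dtr2 (w t) (u t)) t := by
    refine (((G1.mul u1).sub (G2.mul u0)).add ((w2.mul u3).sub (w3.mul u2))).congr_deriv ?_
    simp only [dtr2]; ring
  have := (h1.ofReal_comp).add (h2.ofReal_comp.mul_const Complex.I)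
  have e : ∀ a b : ℝ, (⟨a, b⟩ : ℂ) = a + b * Complex.I := fun a b => by
    apply Complex.ext <;> simp
  rw [e]
  refine this.congr_of_eventuallyEq (Eventually.of_forall fun s => ?_)
  exact e _ _

/-- The rotation speed of the transverse part, up to positive factors. -/
theorem rotation_identity (w u : R4)
    (ht : w 2 * u 2 + w 3 * u 3 = g1 w * u 0 + g2 w * u 1) :
    nsq w * (tr1 w u * dtr2 w u - tr2 w u * dtr1 w u) =
      (hessV w (tr1 w u * w 3 - tr2 w u * g2 w) (-tr1 w u * w 2 + tr2 w u * g1 w)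
        + (-tr1 w u * g2 w - tr2 w u * w 3) ^ 2 + (tr1 w u * g1 w + tr2 w u * w 2) ^ 2)
      + (hessV w (w 2) (w 3) + g1 w ^ 2 + g2 w ^ 2) * (tr1 w u ^ 2 + tr2 w u ^ 2) := by
  -- Expansion of |∇H|² u in the tangent frame |∇H|X₁, |∇H|X₂ and the flow vector (y, g). The flow
  -- vector is itself a linearized solution with zero transverse part, so its coefficient drops out.
  have k0 : nsq w * u 0 = tr1 w u * w 3 - tr2 w u * g2 w +
      (w 2 * u 0 + w 3 * u 1 + g1 w * u 2 + g2 w * u 3) * w 2 := by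
    simp only [nsq, tr1, tr2]; linear_combination (-g1 w) * ht
  have k1 : nsq w * u 1 = -tr1 w u * w 2 + tr2 w u * g1 w +
      (w 2 * u 0 + w 3 * u 1 + g1 w * u 2 + g2 w * u 3) * w 3 := by
    simp only [nsq, tr1, tr2]; linear_combination (-g2 w) * ht
  have k2 : nsq w * u 2 = -tr1 w u * g2 w - tr2 w u * w 3 +
      (w 2 * u 0 + w 3 * u 1 + g1 w * u 2 + g2 w * u 3) * g1 w := by
    simp only [nsq, tr1, tr2]; linear_combination (w 2) * ht
  have k3 : nsq w * u 3 = tr1 w u * g1 w + tr2 w u * w 2 +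
      (w 2 * u 0 + w 3 * u 1 + g1 w * u 2 + g2 w * u 3) * g2 w := by
    simp only [nsq, tr1, tr2]; linear_combination (w 3) * ht
  generalize w 2 * u 0 + w 3 * u 1 + g1 w * u 2 + g2 w * u 3 = a3 at *
  generalize tr1 w u = A1 at *
  generalize tr2 w u = A2 at *
  simp only [dtr1, dtr2, hessV]
  linear_combination
    (A1 * ((2 * w 0 * w 2 + (1 - 2 * w 1) * w 3) - w 2 * (2 * w 0) + w 3 * (1 + 2 * w 1))
      - A2 * (g2 w - g1 w * (2 * w 0) + g2 w * (1 + 2 * w 1))) * k0 +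
    (A1 * (-((1 + 2 * w 1) * w 2 + 2 * w 0 * w 3) - w 2 * (1 - 2 * w 1) + w 3 * (2 * w 0))
      - A2 * (-g1 w - g1 w * (1 - 2 * w 1) + g2 w * (2 * w 0))) * k1 +
    (A1 * (-2 * g2 w) - A2 * (w 3 + (2 * w 0 * w 2 + (1 - 2 * w 1) * w 3))) * k2 +
    (A1 * (2 * g1 w) - A2 * (-w 2 - ((1 + 2 * w 1) * w 2 + 2 * w 0 * w 3))) * k3

theorem rotation_pos {w : R4} (hw : w ∈ S \ saddleCenters) {u : R4}
    (ht : w 2 * u 2 + w 3 * u 3 = g1 w * u 0 + g2 w * u 1) (hu : tr w u ≠ 0) :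
    0 < tr1 w u * dtr2 w u - tr2 w u * dtr1 w u := by
  refine (mul_pos_iff_of_pos_left (nsq_pos hw)).1 ?_
  rw [rotation_identity w u ht]
  have h1 := hess_tangent_nonneg hw (a := tr1 w u * w 3 - tr2 w u * g2 w)
    (b := -tr1 w u * w 2 + tr2 w u * g1 w) (c := -tr1 w u * g2 w - tr2 w u * w 3)
    (d := tr1 w u * g1 w + tr2 w u * w 2) (by ring)
  have h2 : 0 < tr1 w u ^ 2 + tr2 w u ^ 2 := by
    by_contra hc
    apply hu
    have k1 : tr1 w u = 0 := by nlinarith [sq_nonneg (tr1 w u), sq_nonneg (tr2 w u)]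
    have k2 : tr2 w u = 0 := by nlinarith [sq_nonneg (tr1 w u), sq_nonneg (tr2 w u)]
    simp [tr, k1, k2]; rfl
  have := mul_pos (hess_flow_pos hw) h2
  linarith

/-! ### Linear differential equations -/

section LinearODE

variable {E : Type*} [NormedAddCommGroup E] [NormedSpace ℝ E]

/-- The terms of the Dyson series of the linear equation `u' = A u` with `u 0 = v`. -/
def dyson (A : ℝ → E →L[ℝ] E) (v : E) : ℕ → ℝ → E
  | 0 => fun _ => v
  | n + 1 => fun t => ∫ s in (0 : ℝ)..t, A s (dyson A v n s)

variable [CompleteSpace E] {A : ℝ → E →L[ℝ] E}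

theorem hasDerivAt_dyson_succ (hA : Continuous A) (v : E) (n : ℕ) :
    Continuous (dyson A v n) ∧
      ∀ t, HasDerivAt (dyson A v (n + 1)) (A t (dyson A v n t)) t := by
  have key : ∀ n, Continuous (dyson A v n) →
      ∀ t, HasDerivAt (dyson A v (n + 1)) (A t (dyson A v n t)) t := fun n hc t => by
    have h : Continuous fun s => A s (dyson A v n s) := hA.clm_apply hc
    exact intervalIntegral.integral_hasDerivAt_right (h.intervalIntegrable _ _)
      (h.stronglyMeasurableAtFilter _ _) h.continuousAt
  have hc : Continuous (dyson A v n) := by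
    induction n with
    | zero => exact continuous_const
    | succ n ih => exact continuous_iff_continuousAt.2 fun t => (key n ih t).continuousAt
  exact ⟨hc, key n hc⟩

/-- Each integration gains a factor C|t|/(n + 1); the series is dominated by the exponential series.
-/
theorem norm_dyson_le {C : ℝ} (hC : ∀ t, ‖A t‖ ≤ C) (hA : Continuous A) (v : E) (n : ℕ) (t : ℝ) :
    ‖dyson A v n t‖ ≤ ‖v‖ * ((C * |t|) ^ n / n.factorial) := by
  have hC0 : 0 ≤ C := (norm_nonneg _).trans (hC 0)
  induction n generalizing t with
  | zero => simp [dyson]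
  | succ n ih =>
    have h1 : ‖dyson A v (n + 1) t‖ ≤
        ∫ s in Set.uIoc 0 t, C * (‖v‖ * (C ^ n / n.factorial)) * |s - 0| ^ n := by
      refine intervalIntegral.norm_integral_le_integral_norm_uIoc.trans ?_
      refine MeasureTheory.setIntegral_mono ?_ ?_ fun s => ?_
      · exact ((hA.clm_apply (hasDerivAt_dyson_succ hA v n).1).norm.integrableOn_uIoc)
      · exact Continuous.integrableOn_uIoc (by fun_prop)
      · calc ‖A s (dyson A v n s)‖ ≤ ‖A s‖ * ‖dyson A v n s‖ := (A s).le_opNorm _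
          _ ≤ C * (‖v‖ * ((C * |s|) ^ n / n.factorial)) :=
            mul_le_mul (hC s) (ih s) (norm_nonneg _) hC0
          _ = _ := by rw [sub_zero, mul_pow]; ring
    refine h1.trans (le_of_eq ?_)
    rw [MeasureTheory.integral_const_mul, integral_pow_abs_sub_uIoc, sub_zero, Nat.factorial_succ]
    push_cast
    rw [mul_pow]
    field_simp
    ring

/-- Bounded continuous linear differential equations have global solutions. -/
theorem exists_linear_solution {C : ℝ} (hC : ∀ t, ‖A t‖ ≤ C) (hA : Continuous A) (v : E) :
    ∃ u : ℝ → E, u 0 = v ∧ ∀ t, HasDerivAt u (A t (u t)) t := by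
  have hC0 : 0 ≤ C := (norm_nonneg _).trans (hC 0)
  have hsum : ∀ t, Summable fun n => dyson A v n t := fun t =>
    Summable.of_norm_bounded ((Real.summable_pow_div_factorial (C * |t|)).mul_left _)
      fun n => norm_dyson_le hC hA v n t
  have h0 : ∀ n, dyson A v (n + 1) 0 = 0 := fun n => by simp [dyson]
  refine ⟨fun t => ∑' n, dyson A v n t, ?_, fun t => ?_⟩
  · simp only
    rw [(hsum 0).tsum_eq_zero_add]
    simp [dyson]
  · have e : (fun t => ∑' n, dyson A v n t) = fun t => v + ∑' n, dyson A v (n + 1) t := by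
      funext t
      rw [(hsum t).tsum_eq_zero_add]; rfl
    rw [e]
    refine HasDerivAt.const_add v ?_
    simp only
    have e2 : A t (v + ∑' n, dyson A v (n + 1) t) = ∑' n, A t (dyson A v n t) := by
      rw [← ContinuousLinearMap.map_tsum _ (hsum t), (hsum t).tsum_eq_zero_add]; rfl
    rw [e2]
    set R := |t| + 1 with hR
    have hu : Summable fun n : ℕ => C * (‖v‖ * ((C * R) ^ n / n.factorial)) :=
      ((Real.summable_pow_div_factorial (C * R)).mul_left _).mul_left _
    refine hasDerivAt_tsum_of_isPreconnected hu (t := Metric.ball 0 R) (y₀ := 0)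
      Metric.isOpen_ball (convex_ball _ _).isPreconnected
      (fun n y _ => (hasDerivAt_dyson_succ hA v n).2 y) (fun n y hy => ?_) ?_ ?_ ?_
    · have hy' : |y| ≤ R := by simpa using (mem_ball_zero_iff.1 hy).le
      calc ‖A y (dyson A v n y)‖ ≤ ‖A y‖ * ‖dyson A v n y‖ := (A y).le_opNorm _
        _ ≤ C * (‖v‖ * ((C * |y|) ^ n / n.factorial)) :=
            mul_le_mul (hC y) (norm_dyson_le hC hA v n y) (norm_nonneg _) hC0
        _ ≤ _ := by gcongr
    · simp [hR]; positivity
    · simp only [h0]; exact summable_zero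
    · simp [hR]

end LinearODE

/-! ### Continuous arguments -/

/-- Near t, continuity keeps θ within π of θ(t), so θ(s) - θ(t) is the imaginary part of the
principal logarithm of z(s)/z(t). -/
theorem IsContinuousArgumentOn.hasDerivAt {z : ℝ → ℂ} {z' : ℂ} {θ : ℝ → ℝ} {I : Set ℝ}
    (h : IsContinuousArgumentOn z θ I) {t : ℝ} (hI : I ∈ 𝓝 t) (hz : HasDerivAt z z' t) :
    HasDerivAt θ (z' / z t).im t := by
  obtain ⟨r, hr, hrt⟩ := h.2 t (mem_of_mem_nhds hI)
  have hzt : z t ≠ 0 := by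
    rw [hrt]; exact mul_ne_zero (by exact_mod_cast hr.ne') (Complex.exp_ne_zero _)
  have h1 : HasDerivAt (fun s => Complex.log (z s / z t)) (z' / z t) t := by
    have := (hz.div_const (z t)).clog_real (by rw [div_self hzt]; exact Complex.one_mem_slitPlane)
    simpa [div_self hzt] using this
  have h2 : HasDerivAt (fun s => (Complex.log (z s / z t)).im + θ t) (z' / z t).im t :=
    (Complex.imCLM.hasFDerivAt.comp_hasDerivAt t h1).add_const (θ t)
  refine h2.congr_of_eventuallyEq ?_
  have hc : ContinuousAt θ t := h.1.continuousAt hI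
  have hlt : ∀ᶠ s in 𝓝 t, θ s ∈ Ioo (θ t - Real.pi) (θ t + Real.pi) :=
    hc.eventually (Ioo_mem_nhds (by linarith [Real.pi_pos]) (by linarith [Real.pi_pos]))
  filter_upwards [hlt, hI] with s hs hsI
  obtain ⟨r', hr', hrs⟩ := h.2 s hsI
  have e : z s / z t = ((r' / r : ℝ) : ℂ) * Complex.exp (((θ s - θ t : ℝ) : ℂ) * Complex.I) := by
    rw [hrs, hrt]
    push_cast
    rw [sub_mul, Complex.exp_sub]
    field_simp
  rw [e, Complex.log_im, Complex.arg_real_mul _ (div_pos hr' hr), Complex.arg_exp_mul_I,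
    toIocMod_eq_self (hp := Real.two_pi_pos) |>.2]
  · ring
  · constructor <;> linarith [hs.1, hs.2]

theorem exists_continuousArgument {z z' : ℝ → ℂ} (hz : ∀ t, HasDerivAt z (z' t) t)
    (hz' : Continuous z') (h0 : ∀ t, z t ≠ 0) : ∃ θ, IsContinuousArgumentOn z θ univ := by
  have hzc : Continuous z := continuous_iff_continuousAt.2 fun t => (hz t).continuousAt
  have hq : Continuous fun t => z' t / z t := hz'.div hzc h0
  set E : ℝ → ℂ := fun t => ∫ s in (0 : ℝ)..t, z' s / z s with hE
  have hEd : ∀ t, HasDerivAt E (z' t / z t) t := fun t =>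
    intervalIntegral.integral_hasDerivAt_right (hq.intervalIntegrable _ _)
      (hq.stronglyMeasurableAtFilter _ _) hq.continuousAt
  have hEc : Continuous E := continuous_iff_continuousAt.2 fun t => (hEd t).continuousAt
  -- E is a primitive of the logarithmic derivative of z, so z = z(0) exp E, and Im E measures the
  -- variation of the argument.
  have hconst : ∀ t, z t * Complex.exp (-E t) = z 0 := fun t => by
    have hd : ∀ s, HasDerivAt (fun s => z s * Complex.exp (-E s)) 0 s := fun s => by
      refine ((hz s).mul (hEd s).neg.cexp).congr_deriv ?_
      field_simp [h0 s]
      ring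
    have := is_const_of_deriv_eq_zero (fun s => (hd s).differentiableAt)
      (fun s => (hd s).deriv) t 0
    rw [this]; simp [hE]
  refine ⟨fun t => (z 0).arg + (E t).im, by fun_prop, fun t _ => ?_⟩
  refine ⟨‖z 0‖ * Real.exp (E t).re, mul_pos (norm_pos_iff.2 (h0 0)) (Real.exp_pos _), ?_⟩
  have e1 : z t = z 0 * Complex.exp (E t) := by
    rw [← hconst t, mul_assoc, ← Complex.exp_add]; simp
  have e2 : Complex.exp (E t) = Complex.exp ((E t).re) * Complex.exp ((E t).im * Complex.I) := by
    rw [← Complex.exp_add, Complex.re_add_im]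
  rw [e1, e2]
  conv_lhs => rw [← Complex.norm_mul_exp_arg_mul_I (z 0)]
  push_cast
  rw [add_mul, Complex.exp_add]
  ring

theorem IsContinuousArgumentOn.sub_eq_integral {z z' : ℝ → ℂ} {θ : ℝ → ℝ}
    (hz : ∀ t, HasDerivAt z (z' t) t) (hz' : Continuous z')
    (h : IsContinuousArgumentOn z θ univ) (T : ℝ) :
    θ T - θ 0 = ∫ t in (0 : ℝ)..T, (z' t / z t).im := by
  have h0 : ∀ t, z t ≠ 0 := fun t => by
    obtain ⟨r, hr, hrt⟩ := h.2 t (mem_univ t)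
    rw [hrt]; exact mul_ne_zero (by exact_mod_cast hr.ne') (Complex.exp_ne_zero _)
  have hzc : Continuous z := continuous_iff_continuousAt.2 fun t => (hz t).continuousAt
  have hq : Continuous fun t => (z' t / z t).im := Complex.continuous_im.comp (hz'.div hzc h0)
  exact (intervalIntegral.integral_eq_sub_of_hasDerivAt
    (fun t _ => h.hasDerivAt univ_mem (hz t)) (hq.intervalIntegrable _ _)).symm

/-- A continuous function which avoids the multiples of `π` has oscillation less than `π`. -/
theorem abs_sub_lt_pi {δ : ℝ → ℝ} (hδ : Continuous δ) (h : ∀ t, Real.sin (δ t) ≠ 0) (s t : ℝ) :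
    |δ s - δ t| < Real.pi := by
  have hpi := Real.pi_pos
  have key : ∀ s t, δ t - δ s < Real.pi := fun s t => by
    by_contra! hc
    set n : ℤ := ⌊δ t / Real.pi⌋ with hn
    have h1 : n * Real.pi ≤ δ t := by
      rw [← le_div_iff₀ hpi]; exact Int.floor_le _
    have h2 : δ t < (n + 1) * Real.pi := by
      rw [← div_lt_iff₀ hpi]; exact Int.lt_floor_add_one _
    have h3 : δ s ≤ n * Real.pi := by linarith
    obtain ⟨x, hx⟩ := mem_range_of_exists_le_of_exists_ge hδ ⟨s, h3⟩ ⟨t, h1⟩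
    exact h x (by rw [hx, Real.sin_int_mul_pi])
  rw [abs_lt]
  constructor <;> linarith [key s t, key t s]

theorem IsContinuousArgumentOn.continuous {z : ℝ → ℂ} {θ : ℝ → ℝ}
    (h : IsContinuousArgumentOn z θ univ) : Continuous θ :=
  continuousOn_univ.1 h.1

/-- The determinant of two plane vectors given in polar form. -/
theorem det_polar {r r' a b : ℝ} {z z' : ℂ} (hz : z = r * Complex.exp (a * Complex.I))
    (hz' : z' = r' * Complex.exp (b * Complex.I)) :
    z.re * z'.im - z.im * z'.re = r * r' * Real.sin (b - a) := by
  rw [hz, hz', Complex.exp_mul_I, Complex.exp_mul_I, Real.sin_sub]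
  simp [Complex.cos_ofReal_re, Complex.sin_ofReal_re]
  ring

/-- Positivity of the quaternion frame. -/
theorem quaternionFramePositive : QuaternionFramePositive H (S \ saddleCenters) := by
  refine ⟨fun w hw => ⟨?_, omega0_frame (nsq_pos hw)⟩, ?_⟩
  · exact norm_pos_iff.1 (norm_gradient_pos (nsq_pos hw))
  · intro a b w u θ hwS hw hu hθ t ht
    rw [isContinuousArgumentOn_transverse_iff fun t ht => nsq_pos (hwS t ht)] at hθ
    rw [(hθ.hasDerivAt (Ioo_mem_nhds ht.1 ht.2) (hasDerivAt_tr hw hu ht)).deriv]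
    obtain ⟨r, hr, hrt⟩ := hθ.2 t ht
    have h0 : tr (w t) (u t) ≠ 0 := by
      rw [show tr (w t) (u t) = _ from hrt]
      exact mul_ne_zero (by exact_mod_cast hr.ne') (Complex.exp_ne_zero _)
    have := rotation_pos (hwS t ht) (linearized_iff.1 hu t ht).1 h0
    have hn : 0 < Complex.normSq (tr (w t) (u t)) := Complex.normSq_pos.2 h0
    rw [Complex.div_im, ← sub_div]
    refine div_pos ?_ hn
    simp only [tr]
    linarith

/-! ### The rotation set -/

/-- On tangent vectors the symplectic form only sees transverse parts. Together with `omega0_const`,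
this keeps the sign of the determinant of two transverse solutions fixed in time. -/
theorem det_tr {w u v : R4} (hu : w 2 * u 2 + w 3 * u 3 = g1 w * u 0 + g2 w * u 1)
    (hv : w 2 * v 2 + w 3 * v 3 = g1 w * v 0 + g2 w * v 1) :
    tr1 w u * tr2 w v - tr2 w u * tr1 w v = nsq w * omega0 u v := by
  simp only [tr1, tr2, nsq, omega0]
  linear_combination
    (-(w 2 * v 0 + w 3 * v 1 + g1 w * v 2 + g2 w * v 3)) * hu +
    (w 2 * u 0 + w 3 * u 1 + g1 w * u 2 + g2 w * u 3) * hv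

theorem omega0_const {w u v : ℝ → R4} (hu : IsLinearizedSolutionOn H w u univ)
    (hv : IsLinearizedSolutionOn H w v univ) (t s : ℝ) :
    omega0 (u t) (v t) = omega0 (u s) (v s) := by
  have hd : ∀ t, HasDerivAt (fun s => omega0 (u s) (v s)) 0 t := fun t => by
    obtain ⟨-, u0, u1, u2, u3⟩ := linearized_iff.1 hu t (mem_univ _)
    obtain ⟨-, v0, v1, v2, v3⟩ := linearized_iff.1 hv t (mem_univ _)
    refine (((u2.mul v0).sub (u0.mul v2)).add ((u3.mul v1).sub (u1.mul v3))).congr_deriv ?_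
    ring
  exact is_const_of_deriv_eq_zero (fun s => (hd s).differentiableAt) (fun s => (hd s).deriv) t s

theorem continuous_coord {w : ℝ → R4} (h : Continuous w) (i : Fin 4) :
    Continuous fun t => w t i := (EuclideanSpace.proj (𝕜 := ℝ) i).continuous.comp h

theorem IsTrajectoryOn.continuous {H : R4 → ℝ} {w : ℝ → R4} (hw : IsTrajectoryOn H w univ) :
    Continuous w :=
  continuous_iff_continuousAt.2 fun t => (hw t (mem_univ t)).continuousAt

theorem IsLinearizedSolutionOn.continuous {H : R4 → ℝ} {w u : ℝ → R4}
    (hu : IsLinearizedSolutionOn H w u univ) : Continuous u :=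
  continuous_iff_continuousAt.2 fun t => (hu t (mem_univ t)).2.continuousAt

/-- The derivative of the transverse part along the linearized flow. -/
def dtr (w u : R4) : ℂ := ⟨dtr1 w u, dtr2 w u⟩

theorem continuous_dtr {w u : ℝ → R4} (hw : Continuous w) (hu : Continuous u) :
    Continuous fun t => dtr (w t) (u t) := by
  have a := continuous_coord hw
  have b := continuous_coord hu
  have e : ∀ a b : ℝ, (⟨a, b⟩ : ℂ) = a + b * Complex.I := fun a b => by
    apply Complex.ext <;> simp
  simp only [dtr, dtr1, dtr2, g1, g2, e]
  fun_prop

theorem exists_linearized {w : ℝ → R4} {T : ℝ} (hT : 0 < T) (hw : IsTrajectoryOn H w univ)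
    (hp : Function.Periodic w T) (v : R4)
    (hv : w 0 2 * v 2 + w 0 3 * v 3 = g1 (w 0) * v 0 + g2 (w 0) * v 1) :
    ∃ u, IsLinearizedSolutionOn H w u univ ∧ u 0 = v := by
  have hwc := hw.continuous
  let p : Fin 4 → R4 →L[ℝ] ℝ := fun i => EuclideanSpace.proj i
  let e : Fin 4 → R4 := fun i => EuclideanSpace.single i 1
  let A : ℝ → R4 →L[ℝ] R4 := fun t =>
    (p 2).smulRight (e 0) + (p 3).smulRight (e 1)
    - ((1 + 2 * w t 1) • p 0 + (2 * w t 0) • p 1).smulRight (e 2)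
    - ((2 * w t 0) • p 0 + (1 - 2 * w t 1) • p 1).smulRight (e 3)
  have a := continuous_coord hwc
  have hA : Continuous A := by
    have e : A = fun t => (p 2).smulRight (e 0) + (p 3).smulRight (e 1)
      - ((1 + 2 * w t 1) • (p 0).smulRight (e 2) + (2 * w t 0) • (p 1).smulRight (e 2))
      - ((2 * w t 0) • (p 0).smulRight (e 3) + (1 - 2 * w t 1) • (p 1).smulRight (e 3)) := by
      funext t
      ext v i
      simp [A]
      ring
    rw [e]
    fun_prop
  have hAp : Function.Periodic A T := fun t => by simp only [A, hp t]
  -- Periodicity bounds the coefficients, which gives a solution on the whole line.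
  obtain ⟨C, hC⟩ := (hAp.compact_of_continuous hT.ne' hA).isBounded.exists_norm_le
  obtain ⟨u, hu0, hu⟩ := exists_linear_solution (fun t => hC _ (mem_range_self t)) hA v
  refine ⟨u, linearized_iff.2 fun t _ => ?_, hu0⟩
  have hu' : ∀ t, HasDerivAt (fun s => u s 0) (u t 2) t ∧ HasDerivAt (fun s => u s 1) (u t 3) t ∧
    HasDerivAt (fun s => u s 2) (-((1 + 2 * w t 1) * u t 0 + 2 * w t 0 * u t 1)) t ∧
    HasDerivAt (fun s => u s 3) (-(2 * w t 0 * u t 0 + (1 - 2 * w t 1) * u t 1)) t := fun t => by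
    have h := hasDerivAt_R4.1 (hu t)
    refine ⟨(h 0).congr_deriv ?_, (h 1).congr_deriv ?_, (h 2).congr_deriv ?_,
      (h 3).congr_deriv ?_⟩ <;> simp [A, p, e]
  refine ⟨?_, hu' t⟩
  -- ⟨∇H(w), u⟩ is a first integral of the linearized flow, so tangency at time 0 persists.
  have hd : ∀ t, HasDerivAt (fun s => w s 2 * u s 2 + w s 3 * u s 3
      - (g1 (w s) * u s 0 + g2 (w s) * u s 1)) 0 t := fun t => by
    obtain ⟨-, -, w2, w3⟩ := trajectory_iff.1 hw t (mem_univ t)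
    obtain ⟨u0, u1, u2, u3⟩ := hu' t
    have G1 := hasDerivAt_g1 hw (mem_univ t)
    have G2 := hasDerivAt_g2 hw (mem_univ t)
    refine (((w2.mul u2).add (w3.mul u3)).sub ((G1.mul u0).add (G2.mul u1))).congr_deriv ?_
    ring
  have := is_const_of_deriv_eq_zero (fun s => (hd s).differentiableAt) (fun s => (hd s).deriv) t 0
  simp only [hu0] at this
  linarith

/-- Two arguments of transverse linearized solutions move by amounts which differ by less
than `π`. -/
theorem argument_compare {w u v : ℝ → R4} {θ η : ℝ → ℝ} (hwS : ∀ t, w t ∈ S \ saddleCenters)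
    (hu : IsLinearizedSolutionOn H w u univ) (hv : IsLinearizedSolutionOn H w v univ)
    (hθ : IsContinuousArgumentOn (fun t => tr (w t) (u t)) θ univ)
    (hη : IsContinuousArgumentOn (fun t => tr (w t) (v t)) η univ) :
    (omega0 (u 0) (v 0) = 0 ∧ ∀ t, Real.sin (η t - θ t) = 0) ∨
    (∀ t, Real.sin (η t - θ t) ≠ 0) := by
  have key : ∀ t, ∃ c : ℝ, 0 < c ∧ Real.sin (η t - θ t) * c = omega0 (u 0) (v 0) := fun t => by
    obtain ⟨r, hr, h⟩ := hθ.2 t (mem_univ t)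
    obtain ⟨r', hr', h'⟩ := hη.2 t (mem_univ t)
    have := det_polar h h'
    have h2 := det_tr (linearized_iff.1 hu t (mem_univ t)).1 (linearized_iff.1 hv t (mem_univ t)).1
    simp only [tr] at this
    rw [h2, omega0_const hu hv t 0] at this
    have hn := nsq_pos (hwS t)
    refine ⟨r * r' / nsq (w t), by positivity, ?_⟩
    field_simp
    linarith
  by_cases h0 : omega0 (u 0) (v 0) = 0
  · refine Or.inl ⟨h0, fun t => ?_⟩
    obtain ⟨c, hc, h⟩ := key t
    rw [h0] at h
    exact (mul_eq_zero.1 h).resolve_right hc.ne'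
  · refine Or.inr fun t ht => h0 ?_
    obtain ⟨c, hc, h⟩ := key t
    rw [← h, ht, zero_mul]

/-- A continuous function with values in the multiples of `π` is constant. -/
theorem const_of_sin_eq_zero {δ : ℝ → ℝ} (hδ : Continuous δ) (h : ∀ t, Real.sin (δ t) = 0)
    (s t : ℝ) : δ s = δ t := by
  have hpi := Real.pi_pos
  have key : ∀ s t, ¬ δ s < δ t := fun s t hlt => by
    obtain ⟨n, hn⟩ := Real.sin_eq_zero_iff.1 (h s)
    obtain ⟨x, hx⟩ := mem_range_of_exists_le_of_exists_ge hδ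
      -- A value strictly between δ(s) and the next multiple of π, and below δ(t).
      (c := δ s + min (δ t - δ s) Real.pi / 2)
      ⟨s, by have : 0 < min (δ t - δ s) Real.pi := lt_min (by linarith) hpi
             linarith⟩
      ⟨t, by linarith [min_le_left (δ t - δ s) Real.pi]⟩
    obtain ⟨m, hm⟩ := Real.sin_eq_zero_iff.1 (h x)
    have h1 : 0 < min (δ t - δ s) Real.pi := lt_min (by linarith) hpi
    have h2 := min_le_right (δ t - δ s) Real.pi
    have h3 : (n : ℝ) < m := by
      refine lt_of_mul_lt_mul_right ?_ hpi.le
      linarith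
    have h4 : (m : ℝ) < n + 1 := by
      refine lt_of_mul_lt_mul_right ?_ hpi.le
      linarith
    have : n < m := by exact_mod_cast h3
    have : m < n + 1 := by exact_mod_cast h4
    omega
  rcases lt_trichotomy (δ s) (δ t) with h | h | h
  · exact absurd h (key s t)
  · exact h
  · exact absurd h (key t s)

/-- The rotation set of a periodic orbit is a compact interval of length less than `1`. -/
theorem rotationSet_eq_Icc {w : ℝ → R4} {T : ℝ} (hT : 0 < T) (hw : IsTrajectoryOn H w univ)
    (hp : Function.Periodic w T) (hwS : ∀ t, w t ∈ S \ saddleCenters) :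
    ∃ a b : ℝ, a ≤ b ∧ b < a + 1 ∧ rotationSet H w T = Icc a b := by
  have hwc := hw.continuous
  -- The initial values are the frame vectors |∇H|X₁ and |∇H|X₂ at w(0). The corresponding solutions
  -- form a basis of the solutions modulo the flow direction.
  obtain ⟨u, hu, hu0⟩ := exists_linearized hT hw hp
    (!₂[w 0 3, -w 0 2, -g2 (w 0), g1 (w 0)]) (by simp; ring)
  obtain ⟨v, hv, hv0⟩ := exists_linearized hT hw hp
    (!₂[-g2 (w 0), g1 (w 0), -w 0 3, w 0 2]) (by simp; ring)
  have hω : omega0 (u 0) (v 0) = nsq (w 0) := by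
    rw [hu0, hv0]; simp [omega0, nsq]; ring
  have hω0 := nsq_pos (hwS 0)
  have htan : ∀ {u}, IsLinearizedSolutionOn H w u univ → ∀ t,
      w t 2 * u t 2 + w t 3 * u t 3 = g1 (w t) * u t 0 + g2 (w t) * u t 1 :=
    fun hu t => (linearized_iff.1 hu t (mem_univ t)).1
  -- the linearized solutions with polar coordinates `φ`
  let U : ℝ → ℝ → R4 := fun φ t => Real.cos φ • u t + Real.sin φ • v t
  have hU : ∀ φ, IsLinearizedSolutionOn H w (U φ) univ := fun φ t _ => by
    obtain ⟨h1, h2⟩ := hu t (mem_univ t)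
    obtain ⟨h3, h4⟩ := hv t (mem_univ t)
    refine ⟨by simp [U, inner_add_right, inner_smul_right, h1, h3], ?_⟩
    refine ((h2.const_smul (Real.cos φ)).add (h4.const_smul (Real.sin φ))).congr_deriv ?_
    ext i; fin_cases i <;> simp [U, j3] <;> ring
  have hωU : ∀ φ, omega0 (U φ 0) (v 0) = Real.cos φ * nsq (w 0) ∧
      omega0 (u 0) (U φ 0) = Real.sin φ * nsq (w 0) := fun φ => by
    rw [← hω]
    constructor <;> simp [U, omega0] <;> ring
  have htr_ne : ∀ {x y : ℝ → R4}, IsLinearizedSolutionOn H w x univ →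
      IsLinearizedSolutionOn H w y univ → omega0 (x 0) (y 0) ≠ 0 → ∀ t, tr (w t) (x t) ≠ 0 :=
    fun hx hy h t h0 => h <| by
      have := det_tr (htan hx t) (htan hy t)
      have e1 : tr1 (w t) _ = 0 := congrArg Complex.re h0
      have e2 : tr2 (w t) _ = 0 := congrArg Complex.im h0
      rw [e1, e2, omega0_const hx hy t 0] at this
      have := this.symm
      simpa [(nsq_pos (hwS t)).ne'] using this
  have hanti : ∀ x y : R4, omega0 x y = -omega0 y x := fun x y => by simp only [omega0]; ring
  have hUne : ∀ φ t, tr (w t) (U φ t) ≠ 0 := fun φ => by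
    by_cases hc : Real.cos φ = 0
    · refine htr_ne (hU φ) hu ?_
      rw [hanti, (hωU φ).2]
      have : Real.sin φ ≠ 0 := fun hs => by
        have := Real.sin_sq_add_cos_sq φ; rw [hc, hs] at this; norm_num at this
      exact neg_ne_zero.2 (mul_ne_zero this hω0.ne')
    · refine htr_ne (hU φ) hv ?_
      rw [(hωU φ).1]
      exact mul_ne_zero hc hω0.ne'
  have hder : ∀ {x}, IsLinearizedSolutionOn H w x univ → ∀ t,
      HasDerivAt (fun s => tr (w s) (x s)) (dtr (w t) (x t)) t :=
    fun hx t => hasDerivAt_tr hw hx (mem_univ t)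
  -- The rotation number as an explicit integral, so that it depends continuously on the direction φ
  -- without any choice of arguments.
  let R : ℝ → ℝ := fun φ =>
    (∫ t in (0 : ℝ)..T, (dtr (w t) (U φ t) / tr (w t) (U φ t)).im) / (2 * Real.pi)
  have hRc : Continuous R := by
    refine Continuous.div_const ?_ _
    refine intervalIntegral.continuous_parametric_intervalIntegral_of_continuous' ?_ 0 T
    have e1 : ∀ φ t, dtr (w t) (U φ t) =
        (Real.cos φ : ℂ) * dtr (w t) (u t) + (Real.sin φ : ℂ) * dtr (w t) (v t) := fun φ t => by
      apply Complex.ext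
      · rw [Complex.add_re, Complex.re_ofReal_mul, Complex.re_ofReal_mul]
        simp [dtr, dtr1, U]; ring
      · rw [Complex.add_im, Complex.im_ofReal_mul, Complex.im_ofReal_mul]
        simp [dtr, dtr2, U]; ring
    have e2 : ∀ φ t, tr (w t) (U φ t) =
        (Real.cos φ : ℂ) * tr (w t) (u t) + (Real.sin φ : ℂ) * tr (w t) (v t) := fun φ t => by
      apply Complex.ext
      · rw [Complex.add_re, Complex.re_ofReal_mul, Complex.re_ofReal_mul]
        simp [tr, tr1, U]; ring
      · rw [Complex.add_im, Complex.im_ofReal_mul, Complex.im_ofReal_mul]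
        simp [tr, tr2, U]; ring
    have c1 := continuous_dtr hwc hu.continuous
    have c2 := continuous_dtr hwc hv.continuous
    have c3 : Continuous fun t => tr (w t) (u t) :=
      continuous_iff_continuousAt.2 fun t => (hder hu t).continuousAt
    have c4 : Continuous fun t => tr (w t) (v t) :=
      continuous_iff_continuousAt.2 fun t => (hder hv t).continuousAt
    refine Complex.continuous_im.comp (Continuous.div ?_ ?_ fun p => hUne p.1 p.2)
    · simp only [e1]
      exact ((Complex.continuous_ofReal.comp (Real.continuous_cos.comp continuous_fst)).mul
        (c1.comp continuous_snd)).add ((Complex.continuous_ofReal.comp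
        (Real.continuous_sin.comp continuous_fst)).mul (c2.comp continuous_snd))
    · simp only [e2]
      exact ((Complex.continuous_ofReal.comp (Real.continuous_cos.comp continuous_fst)).mul
        (c3.comp continuous_snd)).add ((Complex.continuous_ofReal.comp
        (Real.continuous_sin.comp continuous_fst)).mul (c4.comp continuous_snd))
  have hUarg : ∀ φ, ∃ θ, IsContinuousArgumentOn (fun t => tr (w t) (U φ t)) θ univ := fun φ =>
    exists_continuousArgument (hder (hU φ)) (continuous_dtr hwc (hU φ).continuous) (hUne φ)
  have hRθ : ∀ φ θ, IsContinuousArgumentOn (fun t => tr (w t) (U φ t)) θ univ →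
      (θ T - θ 0) / (2 * Real.pi) = R φ := fun φ θ hθ => by
    rw [hθ.sub_eq_integral (hder (hU φ)) (continuous_dtr hwc (hU φ).continuous)]
  have hset : rotationSet H w T = R '' Icc (-Real.pi) Real.pi := by
    ext r
    constructor
    · rintro ⟨x, θ, hx, hθ, rfl⟩
      rw [isContinuousArgumentOn_transverse_iff fun t _ => nsq_pos (hwS t)] at hθ
      -- By Cramer's rule, the transverse part of x is a constant combination of those of u and v.
      -- The polar angle of the coefficients (a, b) is the parameter φ.
      set a := omega0 (x 0) (v 0)
      set b := omega0 (u 0) (x 0)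
      have hcomb : ∀ t, (nsq (w 0) : ℂ) * tr (w t) (x t) =
          (a : ℂ) * tr (w t) (u t) + (b : ℂ) * tr (w t) (v t) := fun t => by
        have d1 := det_tr (htan hu t) (htan hv t)
        have d2 := det_tr (htan hx t) (htan hv t)
        have d3 := det_tr (htan hu t) (htan hx t)
        rw [omega0_const hu hv t 0, hω] at d1
        rw [omega0_const hx hv t 0] at d2
        rw [omega0_const hu hx t 0] at d3
        have hn := (nsq_pos (hwS t)).ne'
        apply Complex.ext
        · rw [Complex.add_re, Complex.re_ofReal_mul, Complex.re_ofReal_mul, Complex.re_ofReal_mul]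
          apply mul_left_cancel₀ hn
          simp only [tr]
          linear_combination (-tr1 (w t) (x t)) * d1 + tr1 (w t) (u t) * d2 +
            tr1 (w t) (v t) * d3
        · rw [Complex.add_im, Complex.im_ofReal_mul, Complex.im_ofReal_mul, Complex.im_ofReal_mul]
          apply mul_left_cancel₀ hn
          simp only [tr]
          linear_combination (-tr2 (w t) (x t)) * d1 + tr2 (w t) (u t) * d2 +
            tr2 (w t) (v t) * d3
      have hab : (⟨a, b⟩ : ℂ) ≠ 0 := fun h => by
        have ha : a = 0 := congrArg Complex.re h
        have hb : b = 0 := congrArg Complex.im h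
        obtain ⟨r, hr, h⟩ := hθ.2 0 (mem_univ 0)
        have h1 := hcomb 0
        rw [show tr (w 0) (x 0) = _ from h, ha, hb] at h1
        simp [hω0.ne', hr.ne', Complex.exp_ne_zero] at h1
      set φ := Complex.arg ⟨a, b⟩
      set ρ := ‖(⟨a, b⟩ : ℂ)‖
      have hρ : 0 < ρ := norm_pos_iff.2 hab
      have ha : a = ρ * Real.cos φ := (Complex.norm_mul_cos_arg ⟨a, b⟩).symm
      have hb : b = ρ * Real.sin φ := (Complex.norm_mul_sin_arg ⟨a, b⟩).symm
      refine ⟨φ, ⟨(Complex.neg_pi_lt_arg _).le, Complex.arg_le_pi _⟩, ?_⟩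
      refine (hRθ φ θ ⟨hθ.1, fun t ht => ?_⟩).symm
      obtain ⟨r, hr, h⟩ := hθ.2 t ht
      refine ⟨nsq (w 0) * r / ρ, by positivity, ?_⟩
      have h1 := hcomb t
      rw [show tr (w t) (x t) = _ from h, ha, hb] at h1
      have e2 : tr (w t) (U φ t) =
          (Real.cos φ : ℂ) * tr (w t) (u t) + (Real.sin φ : ℂ) * tr (w t) (v t) := by
        apply Complex.ext
        · rw [Complex.add_re, Complex.re_ofReal_mul, Complex.re_ofReal_mul]
          simp [tr, tr1, U]; ring
        · rw [Complex.add_im, Complex.im_ofReal_mul, Complex.im_ofReal_mul]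
          simp [tr, tr2, U]; ring
      have hρ' : (ρ : ℂ) ≠ 0 := by exact_mod_cast hρ.ne'
      simp only [e2]
      apply mul_left_cancel₀ hρ'
      push_cast at h1 ⊢
      field_simp
      linear_combination -h1
    · rintro ⟨φ, -, rfl⟩
      obtain ⟨θ, hθ⟩ := hUarg φ
      refine ⟨U φ, θ, hU φ, ?_, (hRθ φ θ hθ).symm⟩
      rwa [isContinuousArgumentOn_transverse_iff fun t _ => nsq_pos (hwS t)]
  -- The difference of two arguments is either constant or avoids the multiples of π; either way it
  -- varies by less than π.
  have hlen : ∀ φ ψ, |R φ - R ψ| < 1 := fun φ ψ => by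
    obtain ⟨θ, hθ⟩ := hUarg φ
    obtain ⟨η, hη⟩ := hUarg ψ
    rw [← hRθ φ θ hθ, ← hRθ ψ η hη, ← sub_div, abs_div, abs_of_pos Real.two_pi_pos,
      div_lt_one Real.two_pi_pos]
    have hc : Continuous fun t => η t - θ t := hη.continuous.sub hθ.continuous
    have hpi := Real.pi_pos
    rcases argument_compare hwS (hU φ) (hU ψ) hθ hη with ⟨-, h⟩ | h
    · have := const_of_sin_eq_zero hc h T 0
      rw [show θ T - θ 0 - (η T - η 0) = 0 by linarith, abs_zero]
      linarith
    · have := abs_sub_lt_pi hc h 0 T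
      rw [show θ T - θ 0 - (η T - η 0) = η 0 - θ 0 - (η T - θ T) by ring]
      linarith
  have hle : -Real.pi ≤ Real.pi := by linarith [Real.pi_pos]
  have himg := hRc.continuousOn.image_Icc (a := -Real.pi) (b := Real.pi) hle
  have hmem : ∀ r ∈ R '' Icc (-Real.pi) Real.pi, ∀ s ∈ R '' Icc (-Real.pi) Real.pi,
      |r - s| < 1 := by
    rintro _ ⟨φ, -, rfl⟩ _ ⟨ψ, -, rfl⟩; exact hlen φ ψ
  rw [← hset] at himg hmem
  have hne : (rotationSet H w T).Nonempty := by
    rw [hset]; exact (nonempty_Icc.2 hle).image _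
  rw [himg] at hne hmem
  have hab := nonempty_Icc.1 hne
  refine ⟨_, _, hab, ?_, himg⟩
  have := abs_lt.1 (hmem _ (right_mem_Icc.2 hab) _ (left_mem_Icc.2 hab))
  linarith [this.2]

/-! ### The index of an interval of rotation numbers -/

/-- For a > 1 and small ε the shifted interval stays to the right of 1. It lies in some (k, k + 1)
with k ≥ 1, or has an interior integer k ≥ 2. -/
theorem index_of_Icc {w : ℝ → R4} {T a b : ℝ} (hab : a ≤ b) (hlen : b < a + 1) (ha : 1 < a)
    (hI : rotationSet H w T = Icc a b) :
    (∃! μ : ℤ, HasIndex H w T μ) ∧ ∀ μ : ℤ, HasIndex H w T μ → 3 ≤ μ := by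
  have himg : ∀ ε : ℝ, (fun r => r - ε) '' rotationSet H w T = Icc (a - ε) (b - ε) := fun ε => by
    rw [hI, image_sub_const_Icc]
  have key : ∀ μ, HasIndex H w T μ ↔ ∀ᶠ ε in 𝓝[>] (0 : ℝ), ∃ k : ℤ,
      (μ = 2 * k + 1 ∧ (k : ℝ) < a - ε ∧ b - ε < k + 1) ∨
      (μ = 2 * k ∧ a - ε < k ∧ k < b - ε) := fun μ => by
    unfold HasIndex
    refine eventually_congr (Eventually.of_forall fun ε => exists_congr fun k => ?_)
    rw [himg, interior_Icc, mem_Ioo, Icc_subset_Ioo_iff (by linarith)]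
  have hsmall : ∀ c : ℝ, 0 < c → ∀ᶠ ε in 𝓝[>] (0 : ℝ), 0 < ε ∧ ε < c := fun c hc =>
    Ioo_mem_nhdsGT hc
  refine ⟨?_, fun μ hμ => ?_⟩
  -- The largest integer strictly below b. Because the interval is shifted to the left, b = k + 1
  -- still counts as lying below k + 1, and a = k as lying below k.
  · set k : ℤ := ⌈b⌉ - 1 with hk
    have hk1 : (k : ℝ) < b := by
      rw [hk]; push_cast; linarith [Int.ceil_lt_add_one b]
    have hk2 : b ≤ k + 1 := by rw [hk]; push_cast; linarith [Int.le_ceil b]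
    refine existsUnique_of_exists_of_unique ?_ fun μ ν hμ hν => ?_
    · by_cases h : (k : ℝ) < a
      · refine ⟨2 * k + 1, (key _).2 ?_⟩
        filter_upwards [hsmall (a - k) (by linarith)] with ε hε
        exact ⟨k, Or.inl ⟨rfl, by linarith [hε.2], by linarith [hε.1]⟩⟩
      · refine ⟨2 * k, (key _).2 ?_⟩
        filter_upwards [hsmall (b - k) (by linarith)] with ε hε
        exact ⟨k, Or.inr ⟨rfl, by linarith [hε.1], by linarith [hε.2]⟩⟩
    · obtain ⟨ε, ⟨m, hm⟩, ⟨n, hn⟩⟩ := (((key _).1 hμ).and ((key _).1 hν)).exists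
      have cast : ∀ {p q : ℤ}, (p : ℝ) < q + 1 → p ≤ q := fun h => by
        rw [← Int.lt_add_one_iff]; exact_mod_cast h
      rcases hm with ⟨rfl, h1, h2⟩ | ⟨rfl, h1, h2⟩ <;> rcases hn with ⟨rfl, h3, h4⟩ | ⟨rfl, h3, h4⟩
      · have := cast (show (m : ℝ) < n + 1 by linarith)
        have := cast (show (n : ℝ) < m + 1 by linarith)
        omega
      · have := cast (show (n : ℝ) < m + 1 by linarith)
        have : m < n := by exact_mod_cast (show (m : ℝ) < n by linarith)
        omega
      · have := cast (show (m : ℝ) < n + 1 by linarith)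
        have : n < m := by exact_mod_cast (show (n : ℝ) < m by linarith)
        omega
      · have := cast (show (m : ℝ) < n + 1 by linarith)
        have := cast (show (n : ℝ) < m + 1 by linarith)
        omega
  · obtain ⟨ε, ⟨k, hk⟩, hε⟩ := (((key _).1 hμ).and (hsmall (a - 1) (by linarith))).exists
    rcases hk with ⟨rfl, h1, h2⟩ | ⟨rfl, h1, h2⟩
    · have : (0 : ℤ) < k := by
        have : (0 : ℝ) < k := by linarith [hε.2]
        exact_mod_cast this
      omega
    · have : (1 : ℤ) < k := by
        have : (1 : ℝ) < k := by linarith [hε.2]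
        exact_mod_cast this
      omega

/-! ### The second variation along homotheties and translations -/

/-- The determinant of the velocity and of the configuration part of `u`. -/
def jac (w u : R4) : ℝ := w 2 * u 1 - w 3 * u 0

/-- The first component of the vector field `x ↦ (c₀, c₁) + c₂ x`. -/
def xi1 (c : Fin 3 → ℝ) (w : R4) : ℝ := c 0 + c 2 * w 0
/-- The second component of the vector field `x ↦ (c₀, c₁) + c₂ x`. -/
def xi2 (c : Fin 3 → ℝ) (w : R4) : ℝ := c 1 + c 2 * w 1

/-- The determinant of the velocity and the test field. -/
def fieldDet (c : Fin 3 → ℝ) (w : R4) : ℝ := w 2 * xi2 c w - w 3 * xi1 c w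

/-- The numerator of `riccati`. -/
def riccatiNum (c : Fin 3 → ℝ) (w u : R4) : ℝ :=
  fieldDet c w * (u 2 * xi1 c w + u 3 * xi2 c w) -
    (u 0 * xi2 c w - u 1 * xi1 c w) * (g1 w * xi1 c w + g2 w * xi2 c w)

/-- The value of the Riccati form of the linearized solution `u` on the test field. -/
def riccati (c : Fin 3 → ℝ) (w u : R4) : ℝ :=
  riccatiNum c w u / jac w u - 2 * c 2 * (w 2 * xi1 c w + w 3 * xi2 c w)

theorem hasDerivAt_jac {w u : ℝ → R4} (hw : IsTrajectoryOn H w univ)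
    (hu : IsLinearizedSolutionOn H w u univ) (t : ℝ) :
    HasDerivAt (fun s => jac (w s) (u s)) (tr2 (w t) (u t)) t := by
  obtain ⟨-, -, w2, w3⟩ := trajectory_iff.1 hw t (mem_univ t)
  obtain ⟨-, u0, u1, -, -⟩ := linearized_iff.1 hu t (mem_univ t)
  refine ((w2.mul u1).sub (w3.mul u0)).congr_deriv ?_
  simp only [tr2]; ring

theorem hasDerivAt_xi {w : ℝ → R4} (hw : IsTrajectoryOn H w univ) (c : Fin 3 → ℝ) (t : ℝ) :
    HasDerivAt (fun s => xi1 c (w s)) (c 2 * w t 2) t ∧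
    HasDerivAt (fun s => xi2 c (w s)) (c 2 * w t 3) t := by
  obtain ⟨w0, w1, -, -⟩ := trajectory_iff.1 hw t (mem_univ t)
  exact ⟨(w0.const_mul _).const_add _, (w1.const_mul _).const_add _⟩

theorem hasDerivAt_fieldDet {w : ℝ → R4} (hw : IsTrajectoryOn H w univ) (c : Fin 3 → ℝ) (t : ℝ) :
    HasDerivAt (fun s => fieldDet c (w s)) (g1 (w t) * xi2 c (w t) - g2 (w t) * xi1 c (w t)) t := by
  obtain ⟨-, -, w2, w3⟩ := trajectory_iff.1 hw t (mem_univ t)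
  obtain ⟨x1, x2⟩ := hasDerivAt_xi hw c t
  refine ((w2.mul x2).sub (w3.mul x1)).congr_deriv ?_
  ring

/-- The derivative of `riccatiNum` along the linearized flow. -/
def dRiccatiNum (c : Fin 3 → ℝ) (w u : R4) : ℝ :=
  (g1 w * xi2 c w - g2 w * xi1 c w) * (u 2 * xi1 c w + u 3 * xi2 c w) +
    fieldDet c w * (c 2 * (u 2 * w 2 + u 3 * w 3)
      - ((1 + 2 * w 1) * u 0 + 2 * w 0 * u 1) * xi1 c w
      - (2 * w 0 * u 0 + (1 - 2 * w 1) * u 1) * xi2 c w) -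
    (u 2 * xi2 c w - u 3 * xi1 c w - c 2 * jac w u) * (g1 w * xi1 c w + g2 w * xi2 c w) -
    (u 0 * xi2 c w - u 1 * xi1 c w) * (c 2 * (g1 w * w 2 + g2 w * w 3)
      - ((1 + 2 * w 1) * w 2 + 2 * w 0 * w 3) * xi1 c w
      - (2 * w 0 * w 2 + (1 - 2 * w 1) * w 3) * xi2 c w)

theorem hasDerivAt_riccatiNum {w u : ℝ → R4} (hw : IsTrajectoryOn H w univ)
    (hu : IsLinearizedSolutionOn H w u univ) (c : Fin 3 → ℝ) (t : ℝ) :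
    HasDerivAt (fun s => riccatiNum c (w s) (u s)) (dRiccatiNum c (w t) (u t)) t := by
  obtain ⟨x1, x2⟩ := hasDerivAt_xi hw c t
  obtain ⟨-, u0, u1, u2, u3⟩ := linearized_iff.1 hu t (mem_univ t)
  refine (((hasDerivAt_fieldDet hw c t).mul ((u2.mul x1).add (u3.mul x2))).sub
    (((u0.mul x2).sub (u1.mul x1)).mul (((hasDerivAt_g1 hw (mem_univ t)).mul x1).add
    ((hasDerivAt_g2 hw (mem_univ t)).mul x2)))).congr_deriv ?_
  simp only [dRiccatiNum, jac, Pi.add_apply, Pi.mul_apply, Pi.sub_apply]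
  ring

theorem momentum_pos_of_jac_ne_zero {w u : R4} (h : jac w u ≠ 0) : 0 < w 2 ^ 2 + w 3 ^ 2 := by
  rcases momentum_cases w with ⟨h2, h3⟩ | h'
  · simp [jac, h2, h3] at h
  · exact h'

/-- In terms of P, the derivative of ⟨Pξ, ξ⟩ - 2c₂⟨y, ξ⟩ is -V''(ξ, ξ) - |Pξ|² - 2c₂²|y|²: as ξ' =
c₂y and Py = g, the term 2⟨Pξ, ξ'⟩ cancels against the correction. Splitting |Pξ|² along y and its
normal, with ⟨Pξ, y⟩ = ⟨ξ, g⟩, produces the convexity expression. The denominators `jac` and |y|²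
are cleared. -/
theorem riccati_identity (c : Fin 3 → ℝ) (w u : R4)
    (ht : w 2 * u 2 + w 3 * u 3 = g1 w * u 0 + g2 w * u 1) :
    (dRiccatiNum c w u * jac w u - riccatiNum c w u * tr2 w u
      - 2 * c 2 * (g1 w * xi1 c w + g2 w * xi2 c w + c 2 * (w 2 ^ 2 + w 3 ^ 2)) * jac w u ^ 2)
      * (w 2 ^ 2 + w 3 ^ 2) =
    -(((w 2 ^ 2 + w 3 ^ 2) * hessV w (xi1 c w) (xi2 c w) +
        (g1 w * xi1 c w + g2 w * xi2 c w) ^ 2 + 2 * c 2 ^ 2 * (w 2 ^ 2 + w 3 ^ 2) ^ 2) *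
        jac w u ^ 2 +
      ((g1 w * xi2 c w - g2 w * xi1 c w) * jac w u - fieldDet c w * tr2 w u) ^ 2) := by
  simp only [dRiccatiNum, riccatiNum, jac, tr2, fieldDet, hessV]
  generalize xi1 c w = x
  generalize xi2 c w = z
  generalize g1 w = g at *
  generalize g2 w = k at *
  linear_combination
    (-(w 2 ^ 2 + w 3 ^ 2) * ((g * z - k * x) * (u 0 * z - u 1 * x) -
        (u 2 * z - u 3 * x - c 2 * (w 2 * u 1 - w 3 * u 0)) * (w 2 * z - w 3 * x))
      + 2 * (w 2 * z - w 3 * x) * (w 2 * u 1 - w 3 * u 0) *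
        (c 2 * (w 2 ^ 2 + w 3 ^ 2) - (g * x + k * z))
      - (w 2 * z - w 3 * x) ^ 2 * (w 2 * u 2 + w 3 * u 3 - g * u 0 - k * u 1)) * ht

theorem riccati_deriv_neg {w u : ℝ → R4} (hw : IsTrajectoryOn H w univ)
    (hwS : ∀ t, w t ∈ S \ saddleCenters) (hu : IsLinearizedSolutionOn H w u univ)
    {c : Fin 3 → ℝ} (hc : c ≠ 0) {t : ℝ} (hJ : jac (w t) (u t) ≠ 0) :
    ∃ d < 0, HasDerivAt (fun s => riccati c (w s) (u s)) d t := by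
  have hy := momentum_pos_of_jac_ne_zero hJ
  obtain ⟨x1, x2⟩ := hasDerivAt_xi hw c t
  obtain ⟨-, -, w2, w3⟩ := trajectory_iff.1 hw t (mem_univ t)
  have hd := ((hasDerivAt_riccatiNum hw hu c t).div (hasDerivAt_jac hw hu t) hJ).sub
    (((w2.mul x1).add (w3.mul x2)).const_mul (2 * c 2))
  refine ⟨_, ?_, hd⟩
  have hid := riccati_identity c (w t) (u t) (linearized_iff.1 hu t (mem_univ t)).1
  have hpos : 0 < (w t 2 ^ 2 + w t 3 ^ 2) * hessV (w t) (xi1 c (w t)) (xi2 c (w t)) +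
        (g1 (w t) * xi1 c (w t) + g2 (w t) * xi2 c (w t)) ^ 2 +
        2 * c 2 ^ 2 * (w t 2 ^ 2 + w t 3 ^ 2) ^ 2 := by
    -- A nonzero constant field is handled by strict convexity. A field with c₂ ≠ 0 may vanish at
    -- the point, but then the term 2c₂²|y|⁴ is positive.
    by_cases h2 : c 2 = 0
    · have : xi1 c (w t) ≠ 0 ∨ xi2 c (w t) ≠ 0 := by
        by_contra hcon
        push Not at hcon
        simp only [xi1, xi2, h2, zero_mul, add_zero] at hcon
        apply hc
        funext i
        fin_cases i
        · exact hcon.1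
        · exact hcon.2
        · exact h2
      have := convex_pos (hwS t).1 hy this
      positivity
    · have := convex_nonneg (hwS t).1 hy (xi1 c (w t)) (xi2 c (w t))
      have : 0 < 2 * c 2 ^ 2 * (w t 2 ^ 2 + w t 3 ^ 2) ^ 2 := by positivity
      linarith
  have hJ2 : 0 < jac (w t) (u t) ^ 2 := by positivity
  rw [div_sub' (pow_ne_zero 2 hJ)]
  refine div_neg_of_neg_of_pos ?_ hJ2
  refine neg_of_mul_neg_left ?_ hy.le
  have h3 := mul_pos hpos hJ2
  have h4 := sq_nonneg ((g1 (w t) * xi2 c (w t) - g2 (w t) * xi1 c (w t)) * jac (w t) (u t) -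
    fieldDet c (w t) * tr2 (w t) (u t))
  linarith

/-! ### Limits of the Riccati form at singular instants -/

/-- The ratio of two functions at a simple zero of the denominator. -/
theorem tendsto_div_of_hasDerivAt {f g : ℝ → ℝ} {f' g' t : ℝ} (hf : HasDerivAt f f' t)
    (hg : HasDerivAt g g' t) (hf0 : f t = 0) (hg0 : g t = 0) (hg' : g' ≠ 0) :
    Tendsto (fun s => f s / g s) (𝓝[≠] t) (𝓝 (f' / g')) := by
  refine ((hasDerivAt_iff_tendsto_slope.1 hf).div (hasDerivAt_iff_tendsto_slope.1 hg) hg').congr' ?_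
  filter_upwards [self_mem_nhdsWithin] with s hs
  have : s - t ≠ 0 := sub_ne_zero.2 hs
  simp only [slope_def_field, hf0, hg0, sub_zero, Pi.div_apply]
  field_simp

theorem tendsto_riccati_tail {w : ℝ → R4} (hw : IsTrajectoryOn H w univ) (c : Fin 3 → ℝ) (t : ℝ) :
    Tendsto (fun s => 2 * c 2 * (w s 2 * xi1 c (w s) + w s 3 * xi2 c (w s))) (𝓝[≠] t)
      (𝓝 (2 * c 2 * (w t 2 * xi1 c (w t) + w t 3 * xi2 c (w t)))) := by
  obtain ⟨x1, x2⟩ := hasDerivAt_xi hw c t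
  obtain ⟨-, -, w2, w3⟩ := trajectory_iff.1 hw t (mem_univ t)
  exact (((w2.mul x1).add (w3.mul x2)).const_mul
    (2 * c 2)).continuousAt.tendsto.mono_left nhdsWithin_le_nhds

/-- A two-sided limit exists once the numerator vanishes too, so monotonicity carries across the
zero of `jac`. -/
theorem tendsto_riccati_of_simple {w u : ℝ → R4} (hw : IsTrajectoryOn H w univ)
    (hu : IsLinearizedSolutionOn H w u univ) (c : Fin 3 → ℝ) {t : ℝ}
    (hJ : jac (w t) (u t) = 0) (hJ' : tr2 (w t) (u t) ≠ 0) (hN : riccatiNum c (w t) (u t) = 0) :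
    Tendsto (fun s => riccati c (w s) (u s)) (𝓝[≠] t) (𝓝 (dRiccatiNum c (w t) (u t) /
      tr2 (w t) (u t) - 2 * c 2 * (w t 2 * xi1 c (w t) + w t 3 * xi2 c (w t)))) :=
  (tendsto_div_of_hasDerivAt (hasDerivAt_riccatiNum hw hu c t) (hasDerivAt_jac hw hu t) hN hJ
    hJ').sub (tendsto_riccati_tail hw c t)

/-- The limit of the Riccati form at a point where the test field is tangent to the orbit. -/
theorem tendsto_riccati_of_tangent {w u : ℝ → R4} (hw : IsTrajectoryOn H w univ)
    (hu : IsLinearizedSolutionOn H w u univ) (c : Fin 3 → ℝ) {t : ℝ}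
    (hy : 0 < w t 2 ^ 2 + w t 3 ^ 2) (hF : fieldDet c (w t) = 0)
    (hJ : jac (w t) (u t) = 0 → tr2 (w t) (u t) ≠ 0) :
    Tendsto (fun s => riccati c (w s) (u s)) (𝓝[≠] t)
      (𝓝 ((w t 2 * xi1 c (w t) + w t 3 * xi2 c (w t)) *
        (g1 (w t) * xi1 c (w t) + g2 (w t) * xi2 c (w t)) / (w t 2 ^ 2 + w t 3 ^ 2) -
        2 * c 2 * (w t 2 * xi1 c (w t) + w t 3 * xi2 c (w t)))) := by
  refine Tendsto.sub ?_ (tendsto_riccati_tail hw c t)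
  obtain ⟨x1, x2⟩ := hasDerivAt_xi hw c t
  obtain ⟨-, -, w2, w3⟩ := trajectory_iff.1 hw t (mem_univ t)
  obtain ⟨-, u0, u1, u2, u3⟩ := linearized_iff.1 hu t (mem_univ t)
  have G1 := hasDerivAt_g1 hw (mem_univ t)
  have G2 := hasDerivAt_g2 hw (mem_univ t)
  have dF := hasDerivAt_fieldDet hw c t
  have dJ := hasDerivAt_jac hw hu t
  -- By `key` below, `riccatiNum / jac` is `fieldDet`²/`jac` times a continuous function, plus a
  -- continuous function of w alone. The first term tends to 0 even at a zero of `jac`, which is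
  -- simple, since `fieldDet` vanishes there as well. Hence the limit does not depend on u.
  have hquot : Tendsto (fun s => fieldDet c (w s) * (fieldDet c (w s) / jac (w s) (u s)))
      (𝓝[≠] t) (𝓝 0) := by
    have hF' : Tendsto (fun s => fieldDet c (w s)) (𝓝[≠] t) (𝓝 0) := by
      rw [← hF]; exact dF.continuousAt.tendsto.mono_left nhdsWithin_le_nhds
    by_cases hJ0 : jac (w t) (u t) = 0
    · simpa using hF'.mul (tendsto_div_of_hasDerivAt dF dJ hF hJ0 (hJ hJ0))
    · simpa using hF'.mul (hF'.div
        (dJ.continuousAt.tendsto.mono_left nhdsWithin_le_nhds) hJ0)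
  have cont : ∀ {f : ℝ → ℝ}, ContinuousAt f t → Tendsto f (𝓝[≠] t) (𝓝 (f t)) :=
    fun h => h.tendsto.mono_left nhdsWithin_le_nhds
  have c2 := w2.continuousAt
  have c3 := w3.continuousAt
  have d0 := u0.continuousAt
  have d1 := u1.continuousAt
  have d2 := u2.continuousAt
  have d3 := u3.continuousAt
  have k1 := G1.continuousAt
  have k2 := G2.continuousAt
  have m1 := x1.continuousAt
  have m2 := x2.continuousAt
  have n1 := dF.continuousAt
  have hyy : ContinuousAt (fun s => w s 2 ^ 2 + w s 3 ^ 2) t := by fun_prop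
  have hA : ContinuousAt (fun s => ((w s 2 ^ 2 + w s 3 ^ 2) * (w s 2 * u s 3 - w s 3 * u s 2) -
      (w s 2 * g2 (w s) - w s 3 * g1 (w s)) * (w s 2 * u s 0 + w s 3 * u s 1)) /
      (w s 2 ^ 2 + w s 3 ^ 2) ^ 2) t :=
    ContinuousAt.div (by fun_prop) (by fun_prop) (by positivity)
  have hB : ContinuousAt (fun s => (fieldDet c (w s) * (w s 2 * g2 (w s) - w s 3 * g1 (w s)) *
      (w s 2 * xi1 c (w s) + w s 3 * xi2 c (w s)) + (w s 2 ^ 2 + w s 3 ^ 2) *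
      (w s 2 * xi1 c (w s) + w s 3 * xi2 c (w s)) *
      (g1 (w s) * xi1 c (w s) + g2 (w s) * xi2 c (w s))) /
      (w s 2 ^ 2 + w s 3 ^ 2) ^ 2) t :=
    ContinuousAt.div (by fun_prop) (by fun_prop) (by positivity)
  have hJne : ∀ᶠ s in 𝓝[≠] t, jac (w s) (u s) ≠ 0 := by
    by_cases hJ0 : jac (w t) (u t) = 0
    · have := dJ.eventually_ne (c := 0) (hJ hJ0)
      exact this
    · exact (dJ.continuousAt.eventually_ne hJ0).filter_mono nhdsWithin_le_nhds
  have hyne : ∀ᶠ s in 𝓝[≠] t, 0 < w s 2 ^ 2 + w s 3 ^ 2 :=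
    (hyy.eventually (lt_mem_nhds hy)).filter_mono nhdsWithin_le_nhds
  have := (hquot.mul (cont hA)).add (cont hB)
  rw [zero_mul, zero_add] at this
  have hval : (fieldDet c (w t) * (w t 2 * g2 (w t) - w t 3 * g1 (w t)) *
      (w t 2 * xi1 c (w t) + w t 3 * xi2 c (w t)) + (w t 2 ^ 2 + w t 3 ^ 2) *
      (w t 2 * xi1 c (w t) + w t 3 * xi2 c (w t)) *
      (g1 (w t) * xi1 c (w t) + g2 (w t) * xi2 c (w t))) / (w t 2 ^ 2 + w t 3 ^ 2) ^ 2 =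
      (w t 2 * xi1 c (w t) + w t 3 * xi2 c (w t)) *
        (g1 (w t) * xi1 c (w t) + g2 (w t) * xi2 c (w t)) / (w t 2 ^ 2 + w t 3 ^ 2) := by
    rw [hF]; field_simp; ring
  rw [hval] at this
  refine this.congr' ?_
  filter_upwards [hJne, hyne] with s h1 h2
  have htan := (linearized_iff.1 hu s (mem_univ s)).1
  rw [← sub_eq_zero]
  have h2' := h2.ne'
  have key : (w s 2 ^ 2 + w s 3 ^ 2) ^ 2 * riccatiNum c (w s) (u s) = fieldDet c (w s) ^ 2 *
      ((w s 2 ^ 2 + w s 3 ^ 2) * (w s 2 * u s 3 - w s 3 * u s 2) -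
      (w s 2 * g2 (w s) - w s 3 * g1 (w s)) * (w s 2 * u s 0 + w s 3 * u s 1)) +
      jac (w s) (u s) * (fieldDet c (w s) * (w s 2 * g2 (w s) - w s 3 * g1 (w s)) *
      (w s 2 * xi1 c (w s) + w s 3 * xi2 c (w s)) + (w s 2 ^ 2 + w s 3 ^ 2) *
      (w s 2 * xi1 c (w s) + w s 3 * xi2 c (w s)) *
      (g1 (w s) * xi1 c (w s) + g2 (w s) * xi2 c (w s))) := by
    simp only [riccatiNum, fieldDet, jac]
    linear_combination (w s 2 ^ 2 + w s 3 ^ 2) * (w s 2 * xi2 c (w s) - w s 3 * xi1 c (w s)) *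
      (w s 2 * xi1 c (w s) + w s 3 * xi2 c (w s)) * htan
  field_simp
  linear_combination -key

/-- The limit of the Riccati form at a simple zero with vanishing velocity. -/
theorem tendsto_riccati_of_brake {w u : ℝ → R4} (hw : IsTrajectoryOn H w univ)
    (hwS : ∀ t, w t ∈ S \ saddleCenters)
    (hu : IsLinearizedSolutionOn H w u univ) (c : Fin 3 → ℝ) {t : ℝ}
    (h2 : w t 2 = 0) (h3 : w t 3 = 0)
    (hg : g1 (w t) * xi1 c (w t) + g2 (w t) * xi2 c (w t) = 0) (hJ' : tr2 (w t) (u t) ≠ 0) :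
    Tendsto (fun s => riccati c (w s) (u s)) (𝓝[≠] t)
      (𝓝 ((g1 (w t) * xi2 c (w t) - g2 (w t) * xi1 c (w t)) ^ 2 /
        (g1 (w t) ^ 2 + g2 (w t) ^ 2) * (tr1 (w t) (u t) / tr2 (w t) (u t)))) := by
  have hF : fieldDet c (w t) = 0 := by simp [fieldDet, h2, h3]
  have hJ : jac (w t) (u t) = 0 := by simp [jac, h2, h3]
  have hgp := (brake_point (hwS t) h2 h3).1
  have := tendsto_riccati_of_simple hw hu c hJ hJ' (by rw [riccatiNum, hF, hg]; ring)
  convert this using 2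
  rw [dRiccatiNum, hg, hF, hJ, h2, h3]
  have e : (g1 (w t) ^ 2 + g2 (w t) ^ 2) * (u t 2 * xi1 c (w t) + u t 3 * xi2 c (w t)) =
      (g1 (w t) * xi2 c (w t) - g2 (w t) * xi1 c (w t)) * tr1 (w t) (u t) := by
    rw [tr1, h2, h3]
    linear_combination (u t 2 * g1 (w t) + u t 3 * g2 (w t)) * hg
  field_simp
  linear_combination (-(g1 (w t) * xi2 c (w t) - g2 (w t) * xi1 c (w t))) * e

/-- The limit of the Riccati form at a point with vanishing velocity and vanishing test field. -/
theorem tendsto_riccati_of_field_zero {w u : ℝ → R4} (hw : IsTrajectoryOn H w univ)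
    (hwS : ∀ t, w t ∈ S \ saddleCenters)
    (hu : IsLinearizedSolutionOn H w u univ) (c : Fin 3 → ℝ) {t : ℝ}
    (h2 : w t 2 = 0) (h3 : w t 3 = 0) (hx1 : xi1 c (w t) = 0) (hx2 : xi2 c (w t) = 0)
    (h0 : tr (w t) (u t) ≠ 0) :
    Tendsto (fun s => riccati c (w s) (u s)) (𝓝[≠] t) (𝓝 0) := by
  by_cases hJ' : tr2 (w t) (u t) = 0
  swap
  · have := tendsto_riccati_of_brake hw hwS hu c h2 h3 (by rw [hx1, hx2]; ring) hJ'
    rw [hx1, hx2] at this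
    simpa using this
  have hgp := (brake_point (hwS t) h2 h3).1
  have htan := (linearized_iff.1 hu t (mem_univ t)).1
  have h1 : tr1 (w t) (u t) ≠ 0 := fun h => h0 (by simp only [tr, h, hJ']; rfl)
  -- If `tr2` also vanishes, the x-part of u is zero at t and `jac` has a double zero. After
  -- division by (s - t)², the denominator tends to `tr1` ≠ 0 and the numerator to 0, because ξ is
  -- zero at t.
  have hu0 : u t 0 = 0 := by
    rw [tr2, h2, h3] at hJ'
    rw [h2, h3] at htan
    have : (g1 (w t) ^ 2 + g2 (w t) ^ 2) * u t 0 = 0 := by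
      linear_combination (-g1 (w t)) * htan - g2 (w t) * hJ'
    exact (mul_eq_zero.1 this).resolve_left hgp.ne'
  have hu1 : u t 1 = 0 := by
    rw [tr2, h2, h3] at hJ'
    rw [h2, h3] at htan
    have : (g1 (w t) ^ 2 + g2 (w t) ^ 2) * u t 1 = 0 := by
      linear_combination (-g2 (w t)) * htan + g1 (w t) * hJ'
    exact (mul_eq_zero.1 this).resolve_left hgp.ne'
  obtain ⟨x1, x2⟩ := hasDerivAt_xi hw c t
  obtain ⟨-, -, w2, w3⟩ := trajectory_iff.1 hw t (mem_univ t)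
  obtain ⟨-, u0, u1, u2, u3⟩ := linearized_iff.1 hu t (mem_univ t)
  have sl : ∀ {f : ℝ → ℝ} {f' : ℝ}, HasDerivAt f f' t → f t = 0 →
      Tendsto (fun s => f s / (s - t)) (𝓝[≠] t) (𝓝 f') := fun {f f'} hf h0 => by
    refine (hasDerivAt_iff_tendsto_slope.1 hf).congr fun s => ?_
    rw [slope_def_field, h0, sub_zero]
  have cont : ∀ {f : ℝ → ℝ}, ContinuousAt f t → Tendsto f (𝓝[≠] t) (𝓝 (f t)) :=
    fun h => h.tendsto.mono_left nhdsWithin_le_nhds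
  have y2 := sl w2 h2
  have y3 := sl w3 h3
  have a0 := sl u0 hu0
  have a1 := sl u1 hu1
  have b1 := sl x1 hx1
  have b2 := sl x2 hx2
  have E := cont ((u2.mul x1).add (u3.mul x2)).continuousAt
  have K := cont (((hasDerivAt_g1 hw (mem_univ t)).mul x1).add
    ((hasDerivAt_g2 hw (mem_univ t)).mul x2)).continuousAt
  have hden := (y2.mul a1).sub (y3.mul a0)
  have hnum := (((y2.mul b2).sub (y3.mul b1)).mul E).sub (((a0.mul b2).sub (a1.mul b1)).mul K)
  have hne : g1 (w t) * u t 3 - g2 (w t) * u t 2 ≠ 0 := fun h => h1 (by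
    rw [tr1, hu0, hu1, h]; ring)
  have hq := hnum.div hden hne
  have htail := tendsto_riccati_tail hw c t
  have := hq.sub htail
  rw [h2, h3] at this
  simp only [mul_zero, zero_mul, sub_zero, add_zero, zero_div] at this
  refine this.congr' ?_
  filter_upwards [self_mem_nhdsWithin] with s hs
  have : s - t ≠ 0 := sub_ne_zero.2 hs
  simp only [riccati, riccatiNum, fieldDet, jac, Pi.add_apply, Pi.mul_apply, Pi.div_apply]
  congr 1
  have p1 : ∀ a b c d : ℝ, a / (s - t) * (b / (s - t)) - c / (s - t) * (d / (s - t)) =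
      (a * b - c * d) / (s - t) ^ 2 := fun a b c d => by field_simp
  rw [p1, p1, p1, div_mul_eq_mul_div, div_mul_eq_mul_div, ← sub_div,
    div_div_div_cancel_right₀ (pow_ne_zero 2 this)]

/-- A function with negative derivative is larger at the left end than at the right end. -/
theorem lt_of_deriv_neg_Ioo {f : ℝ → ℝ} {a b La Lb : ℝ} (hab : a < b)
    (hf : ∀ t ∈ Ioo a b, ∃ d < 0, HasDerivAt f d t) (ha : Tendsto f (𝓝[≠] a) (𝓝 La))
    (hb : Tendsto f (𝓝[≠] b) (𝓝 Lb)) : Lb < La := by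
  have hanti : StrictAntiOn f (Ioo a b) := by
    refine strictAntiOn_of_deriv_neg (convex_Ioo a b) (fun t ht => ?_) fun t ht => ?_
    · obtain ⟨d, -, hd⟩ := hf t ht
      exact hd.continuousAt.continuousWithinAt
    · rw [interior_Ioo] at ht
      obtain ⟨d, hd0, hd⟩ := hf t ht
      rwa [hd.deriv]
  obtain ⟨m, hm⟩ := exists_between hab
  obtain ⟨n, hn⟩ := exists_between hm.2
  have h1 : f n < f m := hanti hm ⟨hm.1.trans hn.1, hn.2⟩ hn.1
  have h2 : f m ≤ La := by
    refine ge_of_tendsto (ha.mono_left (nhdsWithin_mono a fun x (hx : x ∈ Ioi a) => ne_of_gt hx)) ?_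
    filter_upwards [Ioo_mem_nhdsGT hm.1] with s hs
    exact (hanti ⟨hs.1, hs.2.trans hm.2⟩ hm hs.2).le
  have h3 : Lb ≤ f n := by
    refine le_of_tendsto (hb.mono_left (nhdsWithin_mono b fun x (hx : x ∈ Iio b) => ne_of_lt hx)) ?_
    filter_upwards [Ioo_mem_nhdsLT hn.2] with s hs
    exact (hanti ⟨hm.1.trans hn.1, hn.2⟩ ⟨(hm.1.trans hn.1).trans hs.1, hs.2⟩ hs.1).le
  linarith

/-! ### Linear conditions on the test fields -/

/-- Two linear conditions on the test fields have a common nonzero solution. -/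
theorem exists_field (p q : Fin 3 → ℝ) : ∃ c : Fin 3 → ℝ, c ≠ 0 ∧
    p 0 * c 0 + p 1 * c 1 + p 2 * c 2 = 0 ∧ q 0 * c 0 + q 1 * c 1 + q 2 * c 2 = 0 := by
  have h := LinearMap.ker_ne_bot_of_finrank_lt
    (f := Matrix.mulVecLin !![p 0, p 1, p 2; q 0, q 1, q 2])
    (by simp)
  obtain ⟨c, hc, hc0⟩ := (Submodule.ne_bot_iff _).1 h
  refine ⟨c, hc0, ?_⟩
  rw [LinearMap.mem_ker] at hc
  have h0 := congrFun hc 0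
  have h1 := congrFun hc 1
  simp [Matrix.mulVec, dotProduct, Fin.sum_univ_three] at h0 h1
  exact ⟨h0, h1⟩

/-- The numerator of the Riccati form vanishes at a zero of `jac` under one linear condition. -/
theorem exists_condition {w u : R4} (hJ : jac w u = 0) : ∃ p : Fin 3 → ℝ, ∀ c : Fin 3 → ℝ,
    p 0 * c 0 + p 1 * c 1 + p 2 * c 2 = 0 → riccatiNum c w u = 0 := by
  rcases momentum_cases w with ⟨h2, h3⟩ | h
  · refine ⟨![g1 w, g2 w, g1 w * w 0 + g2 w * w 1], fun c hc => ?_⟩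
    simp at hc
    have : g1 w * xi1 c w + g2 w * xi2 c w = 0 := by simp only [xi1, xi2]; linarith
    simp [riccatiNum, fieldDet, h2, h3, this]
  · refine ⟨![-w 3, w 2, w 2 * w 1 - w 3 * w 0], fun c hc => ?_⟩
    simp at hc
    have hF : w 2 * xi2 c w - w 3 * xi1 c w = 0 := by simp only [xi1, xi2]; linarith
    rw [jac] at hJ
    -- Here y ≠ 0, while ξ and the x-part of u are both parallel to y, hence parallel to each other.
    have hD : u 0 * xi2 c w - u 1 * xi1 c w = 0 := by
      have : (w 2 ^ 2 + w 3 ^ 2) * (u 0 * xi2 c w - u 1 * xi1 c w) = 0 := by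
        linear_combination (w 2 * u 0 + w 3 * u 1) * hF - (w 2 * xi1 c w + w 3 * xi2 c w) * hJ
      exact (mul_eq_zero.1 this).resolve_left h.ne'
    rw [riccatiNum, fieldDet, hF, hD]; ring

/-! ### Rotation relative to the vertical direction -/

/-- A linearized solution along a trajectory, with a continuous argument of its transverse part. -/
structure RotatingSolution (w u : ℝ → R4) (θ : ℝ → ℝ) : Prop where
  traj : IsTrajectoryOn H w univ
  mem : ∀ t, w t ∈ S \ saddleCenters
  lin : IsLinearizedSolutionOn H w u univ
  arg : IsContinuousArgumentOn (fun t => tr (w t) (u t)) θ univ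

/-- The transverse part of the vertical vector `(0, 0, -y₂, y₁)`. -/
def vert (w : R4) : ℂ := ⟨g1 w * w 2 + g2 w * w 3, w 2 ^ 2 + w 3 ^ 2⟩

/-- The angle of a transverse solution relative to the vertical direction. -/
def relAngle (w : ℝ → R4) (θ : ℝ → ℝ) (t : ℝ) : ℝ := θ t - (vert (w t)).arg

theorem arg_vert_mem {w : R4} (hy : 0 < w 2 ^ 2 + w 3 ^ 2) : (vert w).arg ∈ Ioo 0 Real.pi := by
  have h0 : 0 ≤ (vert w).arg := Complex.arg_nonneg_iff.2 hy.le
  have h1 : (vert w).arg ≤ Real.pi := Complex.arg_le_pi _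
  have h2 : 0 < ‖vert w‖ * Real.sin (vert w).arg := by
    rw [Complex.norm_mul_sin_arg]; exact hy
  refine ⟨h0.lt_of_ne fun h => ?_, h1.lt_of_ne fun h => ?_⟩
  · rw [← h, Real.sin_zero, mul_zero] at h2; exact lt_irrefl _ h2
  · rw [h, Real.sin_pi, mul_zero] at h2; exact lt_irrefl _ h2

/-- The default `Complex.arg 0 = 0` is the right limit of the argument of `vert` at an instant of
zero velocity. It makes `relAngle` equal to θ there. -/
theorem arg_vert_of_brake {w : R4} (h2 : w 2 = 0) (h3 : w 3 = 0) : (vert w).arg = 0 := by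
  have : vert w = 0 := by simp only [vert, h2, h3]; apply Complex.ext <;> simp
  rw [this, Complex.arg_zero]

namespace RotatingSolution

variable {w u : ℝ → R4} {θ : ℝ → ℝ}

theorem polar (h : RotatingSolution w u θ) (t : ℝ) : ∃ r : ℝ, 0 < r ∧
    tr1 (w t) (u t) = r * Real.cos (θ t) ∧ tr2 (w t) (u t) = r * Real.sin (θ t) := by
  obtain ⟨r, hr, e⟩ := h.arg.2 t (mem_univ t)
  refine ⟨r, hr, ?_, ?_⟩
  · have := congrArg Complex.re e
    rw [Complex.re_ofReal_mul, Complex.exp_ofReal_mul_I_re] at this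
    exact this
  · have := congrArg Complex.im e
    rw [Complex.im_ofReal_mul, Complex.exp_ofReal_mul_I_im] at this
    exact this

theorem tr_ne_zero (h : RotatingSolution w u θ) (t : ℝ) : tr (w t) (u t) ≠ 0 := by
  obtain ⟨r, hr, e⟩ := h.arg.2 t (mem_univ t)
  rw [show tr (w t) (u t) = _ from e]
  exact mul_ne_zero (by exact_mod_cast hr.ne') (Complex.exp_ne_zero _)

theorem tangent (h : RotatingSolution w u θ) (t : ℝ) :
    w t 2 * u t 2 + w t 3 * u t 3 = g1 (w t) * u t 0 + g2 (w t) * u t 1 :=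
  (linearized_iff.1 h.lin t (mem_univ t)).1

theorem strictMono (h : RotatingSolution w u θ) : StrictMono θ := by
  refine strictMono_of_deriv_pos fun t => ?_
  refine quaternionFramePositive.2 (t - 1) (t + 1) w u θ (fun s _ => h.mem s)
    (fun s _ => h.traj s (mem_univ s)) (fun s _ => h.lin s (mem_univ s)) ?_ t
    ⟨by linarith, by linarith⟩
  rw [isContinuousArgumentOn_transverse_iff fun t _ => nsq_pos (h.mem t)]
  exact ⟨h.arg.1.mono (subset_univ _), fun s _ => h.arg.2 s (mem_univ s)⟩

/-- Up to positive factors, `jac` is the determinant of the transverse parts of the vertical vector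
and of u. -/
theorem jac_eq_sin (h : RotatingSolution w u θ) {t : ℝ} (hy : 0 < w t 2 ^ 2 + w t 3 ^ 2) :
    ∃ m : ℝ, 0 < m ∧ jac (w t) (u t) = m * Real.sin (relAngle w θ t) := by
  obtain ⟨r, hr, e⟩ := h.arg.2 t (mem_univ t)
  have hn := nsq_pos (h.mem t)
  have hv : 0 < ‖vert (w t)‖ := by
    refine norm_pos_iff.2 fun h0 => ?_
    have : w t 2 ^ 2 + w t 3 ^ 2 = 0 := congrArg Complex.im h0
    exact hy.ne' this
  have hd := det_polar (Complex.norm_mul_exp_arg_mul_I (vert (w t))).symm e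
  have hid : (vert (w t)).re * tr2 (w t) (u t) - (vert (w t)).im * tr1 (w t) (u t) =
      nsq (w t) * jac (w t) (u t) := by
    simp only [vert, tr1, tr2, nsq, jac]
    linear_combination (w t 2 * g2 (w t) - w t 3 * g1 (w t)) * h.tangent t
  simp only [tr] at hd
  rw [hid] at hd
  refine ⟨‖vert (w t)‖ * r / nsq (w t), by positivity, ?_⟩
  rw [relAngle, div_mul_eq_mul_div, eq_div_iff hn.ne']
  linarith

theorem continuousAt_relAngle (h : RotatingSolution w u θ) {t : ℝ}
    (hy : 0 < w t 2 ^ 2 + w t 3 ^ 2) : ContinuousAt (relAngle w θ) t := by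
  refine h.arg.continuous.continuousAt.sub ?_
  have hs : vert (w t) ∈ Complex.slitPlane := Or.inr hy.ne'
  refine ContinuousAt.comp (g := Complex.arg) (Complex.continuousAt_arg hs) ?_
  have a := continuous_coord h.traj.continuous
  have e : ∀ a b : ℝ, (⟨a, b⟩ : ℂ) = a + b * Complex.I := fun a b => by
    apply Complex.ext <;> simp
  have k1 := (hasDerivAt_g1 h.traj (mem_univ t)).continuousAt
  have k2 := (hasDerivAt_g2 h.traj (mem_univ t)).continuousAt
  have c1 := (k1.mul (a 2).continuousAt).add (k2.mul (a 3).continuousAt)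
  have c2 := (((a 2).pow 2).add ((a 3).pow 2)).continuousAt (x := t)
  exact ((Complex.continuous_ofReal.continuousAt.comp c1).add
    ((Complex.continuous_ofReal.continuousAt.comp c2).mul continuousAt_const)).congr
    (Eventually.of_forall fun s => (e _ _).symm)

theorem hasDerivAt_vert (h : RotatingSolution w u θ) {t : ℝ} (h2 : w t 2 = 0) (h3 : w t 3 = 0) :
    HasDerivAt (fun s => vert (w s)) ((g1 (w t) ^ 2 + g2 (w t) ^ 2 : ℝ) : ℂ) t := by
  obtain ⟨-, -, w2, w3⟩ := trajectory_iff.1 h.traj t (mem_univ t)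
  have G1 := hasDerivAt_g1 h.traj (mem_univ t)
  have G2 := hasDerivAt_g2 h.traj (mem_univ t)
  have e : ∀ a b : ℝ, (⟨a, b⟩ : ℂ) = a + b * Complex.I := fun a b => by
    apply Complex.ext <;> simp
  have := (((G1.mul w2).add (G2.mul w3)).ofReal_comp).add
    (((w2.pow 2).add (w3.pow 2)).ofReal_comp.mul_const Complex.I)
  refine (this.congr_deriv ?_).congr_of_eventuallyEq (Eventually.of_forall fun s => e _ _)
  rw [h2, h3]
  push_cast
  ring

/-- Near an instant t with y = 0, `vert` is (s - t)|g|² to first order, with nonnegative imaginary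
part. Its argument tends to 0 from the right and to π from the left, so `relAngle` jumps up by π. -/
theorem tendsto_relAngle_right (h : RotatingSolution w u θ) {t : ℝ} (h2 : w t 2 = 0)
    (h3 : w t 3 = 0) : Tendsto (relAngle w θ) (𝓝[>] t) (𝓝 (θ t)) := by
  have hg := (brake_point (h.mem t) h2 h3).1
  have hv0 : vert (w t) = 0 := by simp only [vert, h2, h3]; apply Complex.ext <;> simp
  have hs := hasDerivAt_iff_tendsto_slope.1 (h.hasDerivAt_vert h2 h3)
  have ha : Tendsto (fun s => (slope (fun s => vert (w s)) t s).arg) (𝓝[>] t) (𝓝 0) := by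
    have hc := Complex.continuousAt_arg (Complex.ofReal_mem_slitPlane.2 hg)
    have := hc.tendsto.comp
      (hs.mono_left (nhdsWithin_mono t fun x (hx : x ∈ Ioi t) => ne_of_gt hx))
    rwa [Complex.arg_ofReal_of_nonneg hg.le] at this
  have hθ : Tendsto θ (𝓝[>] t) (𝓝 (θ t)) :=
    h.arg.continuous.continuousAt.tendsto.mono_left nhdsWithin_le_nhds
  have := hθ.sub ha
  rw [sub_zero] at this
  refine this.congr' ?_
  filter_upwards [self_mem_nhdsWithin] with s hs
  have hst : 0 < (s - t)⁻¹ := inv_pos.2 (sub_pos.2 hs)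
  rw [relAngle, slope_def_module, hv0, sub_zero, Complex.real_smul, Complex.arg_real_mul _ hst]

theorem tendsto_relAngle_left (h : RotatingSolution w u θ) {t : ℝ} (h2 : w t 2 = 0)
    (h3 : w t 3 = 0) : Tendsto (relAngle w θ) (𝓝[<] t) (𝓝 (θ t - Real.pi)) := by
  have hg := (brake_point (h.mem t) h2 h3).1
  have hv0 : vert (w t) = 0 := by simp only [vert, h2, h3]; apply Complex.ext <;> simp
  have hs := hasDerivAt_iff_tendsto_slope.1 (h.hasDerivAt_vert h2 h3)
  have hform : ∀ s < t, -slope (fun s => vert (w s)) t s = ((t - s)⁻¹ : ℝ) * vert (w s) :=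
    fun s hs => by
      rw [slope_def_module, hv0, sub_zero, Complex.real_smul, ← neg_mul, ← Complex.ofReal_neg,
        ← inv_neg, neg_sub]
  have ha : Tendsto (fun s => (-slope (fun s => vert (w s)) t s).arg) (𝓝[<] t) (𝓝 Real.pi) := by
    have hc := Complex.tendsto_arg_nhdsWithin_im_nonneg_of_re_neg_of_im_zero
      (z := -((g1 (w t) ^ 2 + g2 (w t) ^ 2 : ℝ) : ℂ))
      (by rw [Complex.neg_re, Complex.ofReal_re]; linarith)
      (by rw [Complex.neg_im, Complex.ofReal_im, neg_zero])
    refine hc.comp (tendsto_nhdsWithin_iff.2 ⟨?_, ?_⟩)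
    · exact (hs.mono_left (nhdsWithin_mono t fun x (hx : x ∈ Iio t) => ne_of_lt hx)).neg
    · filter_upwards [self_mem_nhdsWithin] with s hs
      rw [hform s hs, Complex.im_ofReal_mul]
      have : 0 ≤ (vert (w s)).im := by simp only [vert]; positivity
      exact mul_nonneg (inv_nonneg.2 (sub_nonneg.2 (le_of_lt hs))) this
  have hθ : Tendsto θ (𝓝[<] t) (𝓝 (θ t)) :=
    h.arg.continuous.continuousAt.tendsto.mono_left nhdsWithin_le_nhds
  refine (hθ.sub ha).congr' ?_
  filter_upwards [self_mem_nhdsWithin] with s hs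
  rw [relAngle, hform s hs, Complex.arg_real_mul _ (inv_pos.2 (sub_pos.2 hs))]

/-- The derivative of `jac` is `tr2` = r sin θ. As θ is strictly increasing, it lies strictly inside
(kπ, (k + 1)π) just after t, even if θ(t) = kπ; the mean value theorem then gives the sign at
degenerate zeros too. -/
theorem jac_pos_right (h : RotatingSolution w u θ) {t : ℝ} {k : ℤ} (hJ : jac (w t) (u t) = 0)
    (h1 : k * Real.pi ≤ θ t) (h2 : θ t < (k + 1) * Real.pi) :
    ∀ᶠ s in 𝓝[>] t, 0 < (-1 : ℝ) ^ k * jac (w s) (u s) := by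
  have hθ : ∀ᶠ s in 𝓝[>] t, θ s < (k + 1) * Real.pi :=
    (h.arg.continuous.continuousAt.eventually (gt_mem_nhds h2)).filter_mono nhdsWithin_le_nhds
  filter_upwards [hθ, self_mem_nhdsWithin] with s hs hst
  have hst : t < s := hst
  have hd := fun x => hasDerivAt_jac h.traj h.lin x
  obtain ⟨c, hc, e⟩ := exists_hasDerivAt_eq_slope (fun s => jac (w s) (u s)) _ hst
    (fun x _ => (hd x).continuousAt.continuousWithinAt) fun x _ => hd x
  obtain ⟨r, hr, -, e2⟩ := h.polar c
  have hs0 : 0 < s - t := sub_pos.2 hst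
  rw [hJ, sub_zero, eq_div_iff hs0.ne'] at e
  rw [← e, e2]
  have : 0 < (-1 : ℝ) ^ k * Real.sin (θ c) := by
    rw [← Real.sin_sub_int_mul_pi]
    have := h.strictMono hc.1
    have := h.strictMono hc.2
    exact Real.sin_pos_of_pos_of_lt_pi (by linarith) (by linarith)
  have := mul_pos (mul_pos hr this) hs0
  linarith

theorem jac_neg_left (h : RotatingSolution w u θ) {t : ℝ} {k : ℤ} (hJ : jac (w t) (u t) = 0)
    (h1 : k * Real.pi < θ t) (h2 : θ t ≤ (k + 1) * Real.pi) :
    ∀ᶠ s in 𝓝[<] t, (-1 : ℝ) ^ k * jac (w s) (u s) < 0 := by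
  have hθ : ∀ᶠ s in 𝓝[<] t, k * Real.pi < θ s :=
    (h.arg.continuous.continuousAt.eventually (lt_mem_nhds h1)).filter_mono nhdsWithin_le_nhds
  filter_upwards [hθ, self_mem_nhdsWithin] with s hs hst
  have hst : s < t := hst
  have hd := fun x => hasDerivAt_jac h.traj h.lin x
  obtain ⟨c, hc, e⟩ := exists_hasDerivAt_eq_slope (fun s => jac (w s) (u s)) _ hst
    (fun x _ => (hd x).continuousAt.continuousWithinAt) fun x _ => hd x
  obtain ⟨r, hr, -, e2⟩ := h.polar c
  have hs0 : 0 < t - s := sub_pos.2 hst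
  rw [hJ, zero_sub, eq_div_iff hs0.ne'] at e
  rw [← neg_eq_iff_eq_neg.2 e, e2]
  have : 0 < (-1 : ℝ) ^ k * Real.sin (θ c) := by
    rw [← Real.sin_sub_int_mul_pi]
    have := h.strictMono hc.1
    have := h.strictMono hc.2
    exact Real.sin_pos_of_pos_of_lt_pi (by linarith) (by linarith)
  have := mul_pos (mul_pos hr this) hs0
  linarith

theorem relAngle_gt_right_of_tendsto (h : RotatingSolution w u θ) {t : ℝ} {k : ℤ}
    (hJ : jac (w t) (u t) = 0) (h1 : k * Real.pi ≤ θ t) (h2 : θ t < (k + 1) * Real.pi)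
    (hlim : Tendsto (relAngle w θ) (𝓝[>] t) (𝓝 (k * Real.pi))) :
    ∀ᶠ s in 𝓝[>] t, k * Real.pi < relAngle w θ s := by
  have hpi := Real.pi_pos
  filter_upwards [h.jac_pos_right hJ h1 h2,
    hlim.eventually (lt_mem_nhds (show k * Real.pi - Real.pi < k * Real.pi by linarith))]
    with s hs hs2
  have hne : jac (w s) (u s) ≠ 0 := fun h0 => by simp [h0] at hs
  obtain ⟨m, hm, e⟩ := h.jac_eq_sin (momentum_pos_of_jac_ne_zero hne)
  rw [e, mul_left_comm, ← Real.sin_sub_int_mul_pi] at hs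
  have hs' := (mul_pos_iff_of_pos_left hm).1 hs
  by_contra! hc
  have := Real.sin_nonpos_of_nonpos_of_neg_pi_le (x := relAngle w θ s - k * Real.pi)
    (by linarith) (by linarith)
  linarith

/-- Just above kπ the sine would give `jac` the sign (-1)^k, opposite to the sign found in
`jac_neg_left`. -/
theorem relAngle_not_gt_left_of_tendsto (h : RotatingSolution w u θ) {t : ℝ} {k : ℤ}
    (hJ : jac (w t) (u t) = 0) (h1 : k * Real.pi < θ t) (h2 : θ t ≤ (k + 1) * Real.pi)
    (hlim : Tendsto (relAngle w θ) (𝓝[<] t) (𝓝 (k * Real.pi)))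
    (hgt : ∀ᶠ s in 𝓝[<] t, k * Real.pi < relAngle w θ s) : False := by
  have hpi := Real.pi_pos
  obtain ⟨s, ⟨hs, hs2⟩, hs3⟩ := (((h.jac_neg_left hJ h1 h2).and
    (hlim.eventually (gt_mem_nhds (show k * Real.pi < k * Real.pi + Real.pi by linarith)))).and
    hgt).exists
  have hne : jac (w s) (u s) ≠ 0 := fun h0 => by simp [h0] at hs
  obtain ⟨m, hm, e⟩ := h.jac_eq_sin (momentum_pos_of_jac_ne_zero hne)
  rw [e, mul_left_comm, ← Real.sin_sub_int_mul_pi] at hs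
  have := mul_pos hm (Real.sin_pos_of_pos_of_lt_pi (x := relAngle w θ s - k * Real.pi)
    (by linarith) (by linarith))
  linarith

theorem sin_relAngle_eq_zero_iff (h : RotatingSolution w u θ) {t : ℝ}
    (hy : 0 < w t 2 ^ 2 + w t 3 ^ 2) : Real.sin (relAngle w θ t) = 0 ↔ jac (w t) (u t) = 0 := by
  obtain ⟨m, hm, e⟩ := h.jac_eq_sin hy
  rw [e, mul_eq_zero, or_iff_right hm.ne']

theorem relAngle_right (h : RotatingSolution w u θ) {t : ℝ} {k : ℤ}
    (hk : k * Real.pi ≤ relAngle w θ t) : ∀ᶠ s in 𝓝[>] t, k * Real.pi < relAngle w θ s := by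
  have hpi := Real.pi_pos
  rcases momentum_cases (w t) with ⟨h2, h3⟩ | hy
  · have e : relAngle w θ t = θ t := by rw [relAngle, arg_vert_of_brake h2 h3, sub_zero]
    have hlim := h.tendsto_relAngle_right h2 h3
    rw [e] at hk
    rcases hk.lt_or_eq with hk | hk
    · exact hlim.eventually (lt_mem_nhds hk)
    · rw [← hk] at hlim
      exact h.relAngle_gt_right_of_tendsto (by simp [jac, h2, h3]) hk.le (by linarith) hlim
  · have hc := h.continuousAt_relAngle hy
    rcases hk.lt_or_eq with hk | hk
    · exact (hc.eventually (lt_mem_nhds hk)).filter_mono nhdsWithin_le_nhds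
    · have hlim := hc.tendsto.mono_left (nhdsWithin_le_nhds (s := Ioi t))
      have harg := arg_vert_mem hy
      rw [← hk] at hlim
      rw [relAngle] at hk
      refine h.relAngle_gt_right_of_tendsto ?_ (by linarith [harg.1]) (by linarith [harg.2]) hlim
      rw [← h.sin_relAngle_eq_zero_iff hy, relAngle, ← hk, Real.sin_int_mul_pi]

theorem int_succ_mul_pi_le {x : ℝ} {k : ℤ} (hx : Real.sin x = 0) (hk : k * Real.pi < x) :
    (k + 1) * Real.pi ≤ x := by
  obtain ⟨n, rfl⟩ := Real.sin_eq_zero_iff.1 hx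
  have h1 : (k : ℝ) < n := lt_of_mul_lt_mul_right hk Real.pi_pos.le
  have h2 : k < n := by exact_mod_cast h1
  have h3 : (k : ℝ) + 1 ≤ n := by exact_mod_cast h2
  exact mul_le_mul_of_nonneg_right h3 Real.pi_pos.le

/-- A vertical instant costs one further multiple of π, a degenerate one costs two. At zero velocity
the gain comes from the jump by π. -/
theorem relAngle_left (h : RotatingSolution w u θ) {t : ℝ} {k : ℤ}
    (hk : ∀ᶠ s in 𝓝[<] t, k * Real.pi < relAngle w θ s) :
    k * Real.pi < relAngle w θ t ∧
    (jac (w t) (u t) = 0 → (k + 1) * Real.pi ≤ relAngle w θ t) ∧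
    (jac (w t) (u t) = 0 → tr2 (w t) (u t) = 0 → (k + 2) * Real.pi ≤ relAngle w θ t) := by
  have hpi := Real.pi_pos
  rcases momentum_cases (w t) with ⟨h2, h3⟩ | hy
  · have e : relAngle w θ t = θ t := by rw [relAngle, arg_vert_of_brake h2 h3, sub_zero]
    have hlim := h.tendsto_relAngle_left h2 h3
    have h1 : k * Real.pi ≤ θ t - Real.pi :=
      ge_of_tendsto hlim (hk.mono fun s hs => hs.le)
    rw [e]
    refine ⟨by linarith, fun _ => by linarith, fun hJ htr => ?_⟩
    obtain ⟨r, hr, -, e2⟩ := h.polar t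
    have hsin : Real.sin (θ t) = 0 := by
      rw [htr] at e2; exact (mul_eq_zero.1 e2.symm).resolve_left hr.ne'
    -- If θ(t) = (k + 1)π, the left limit of `relAngle` would be kπ, approached from above, against
    -- the sign of `jac`. The next multiple of π is therefore (k + 2)π.
    have hlt : ((k + 1 : ℤ) : ℝ) * Real.pi < θ t := by
      push_cast
      refine lt_of_le_of_ne (by linarith) fun heq => ?_
      refine h.relAngle_not_gt_left_of_tendsto (k := k) hJ (by linarith) (by linarith) ?_ hk
      rwa [← heq, show ((k : ℝ) + 1) * Real.pi - Real.pi = k * Real.pi by ring] at hlim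
    have := int_succ_mul_pi_le hsin hlt
    push_cast at this
    linarith
  · have hc := h.continuousAt_relAngle hy
    have hlim := hc.tendsto.mono_left (nhdsWithin_le_nhds (s := Iio t))
    have h1 : k * Real.pi ≤ relAngle w θ t :=
      ge_of_tendsto hlim (hk.mono fun s hs => hs.le)
    have harg := arg_vert_mem hy
    have hlt : k * Real.pi < relAngle w θ t := by
      refine lt_of_le_of_ne h1 fun heq => ?_
      rw [← heq] at hlim
      rw [relAngle] at heq
      refine h.relAngle_not_gt_left_of_tendsto (k := k) ?_ (by linarith [harg.1])
        (by linarith [harg.2]) hlim hk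
      rw [← h.sin_relAngle_eq_zero_iff hy, relAngle, ← heq, Real.sin_int_mul_pi]
    refine ⟨hlt, fun hJ => int_succ_mul_pi_le ((h.sin_relAngle_eq_zero_iff hy).2 hJ) hlt,
      fun hJ htr => ?_⟩
    -- With y ≠ 0 the argument of `vert` lies strictly between 0 and π, so `jac` and `tr2` cannot
    -- vanish together.
    exfalso
    have hs := (h.sin_relAngle_eq_zero_iff hy).2 hJ
    obtain ⟨r, hr, -, e2⟩ := h.polar t
    have hsin : Real.sin (θ t) = 0 := by
      rw [htr] at e2; exact (mul_eq_zero.1 e2.symm).resolve_left hr.ne'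
    obtain ⟨n, hn⟩ := Real.sin_eq_zero_iff.1 hsin
    have : Real.sin (vert (w t)).arg = 0 := by
      rw [relAngle, ← hn, ← neg_sub, Real.sin_neg, Real.sin_sub_int_mul_pi, neg_eq_zero] at hs
      exact (mul_eq_zero.1 hs).resolve_left (zpow_ne_zero _ (by norm_num))
    exact (Real.sin_pos_of_pos_of_lt_pi harg.1 harg.2).ne' this

/-- The relative angle crosses the multiples of `π` only upwards. -/
theorem relAngle_gt (h : RotatingSolution w u θ) {a t : ℝ} {k : ℤ}
    (hk : k * Real.pi ≤ relAngle w θ a) (hat : a < t) : k * Real.pi < relAngle w θ t := by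
  by_contra! hc
  -- At the first return time m to the level kπ, `relAngle_left` excludes m itself, and
  -- `relAngle_right` excludes the times just after it.
  set A : Set ℝ := {s | a < s ∧ relAngle w θ s ≤ k * Real.pi} with hA
  have hne : A.Nonempty := ⟨t, hat, hc⟩
  have hbdd : BddBelow A := ⟨a, fun s hs => hs.1.le⟩
  set m := sInf A
  have hright : ∀ x, (∀ᶠ s in 𝓝[>] x, k * Real.pi < relAngle w θ s) →
      ∃ y > x, ∀ s ∈ Ioo x y, k * Real.pi < relAngle w θ s := fun x hx => by
    obtain ⟨y, hy, hs⟩ := mem_nhdsGT_iff_exists_Ioo_subset.1 hx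
    exact ⟨y, hy, fun s hs' => hs hs'⟩
  obtain ⟨y, hy, hys⟩ := hright a (h.relAngle_right hk)
  have hym : y ≤ m := le_csInf hne fun s hs => by
    by_contra! hsy
    exact absurd (hys s ⟨hs.1, hsy⟩) (not_lt.2 hs.2)
  have ham : a < m := lt_of_lt_of_le hy hym
  have hm : k * Real.pi < relAngle w θ m := (h.relAngle_left (by
    filter_upwards [Ioo_mem_nhdsLT ham] with s hs
    by_contra! hcs
    exact absurd (csInf_le hbdd (show s ∈ A from ⟨hs.1, hcs⟩)) (not_le.2 hs.2))).1
  obtain ⟨z, hz, hzs⟩ := hright m (h.relAngle_right hm.le)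
  obtain ⟨s, hs, hsz⟩ := exists_lt_of_csInf_lt hne hz
  rcases (csInf_le hbdd hs).lt_or_eq with hlt | heq
  · exact absurd (hzs s ⟨hlt, hsz⟩) (not_lt.2 hs.2)
  · exact absurd (heq ▸ hm) (not_lt.2 hs.2)

theorem relAngle_at_zero (h : RotatingSolution w u θ) {a t : ℝ} {k : ℤ}
    (hk : k * Real.pi ≤ relAngle w θ a) (hat : a < t) (hJ : jac (w t) (u t) = 0) :
    (k + 1) * Real.pi ≤ relAngle w θ t ∧
    (tr2 (w t) (u t) = 0 → (k + 2) * Real.pi ≤ relAngle w θ t) := by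
  have := h.relAngle_left (t := t) (k := k) (by
    filter_upwards [Ioo_mem_nhdsLT hat] with s hs
    exact h.relAngle_gt hk hs.1)
  exact ⟨this.2.1 hJ, this.2.2 hJ⟩

/-- If a transverse solution makes at most one turn during a period, it does so for all
starting times. -/
theorem turn_le (h : RotatingSolution w u θ) {T : ℝ} (hp : Function.Periodic w T)
    (hT : θ T - θ 0 ≤ 2 * Real.pi) (t : ℝ) : θ (t + T) - θ t ≤ 2 * Real.pi := by
  -- By periodicity of w, the time shift of u is again a linearized solution. The angle from u to
  -- its shift is thus constant or never a multiple of π, and cannot cross 2π.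
  have hv : IsLinearizedSolutionOn H w (fun s => u (s + T)) univ := fun s _ => by
    obtain ⟨h1, h2⟩ := h.lin (s + T) (mem_univ _)
    rw [hp s] at h1 h2
    exact ⟨h1, h2.comp_add_const s T⟩
  have hη : IsContinuousArgumentOn (fun s => tr (w s) (u (s + T))) (fun s => θ (s + T)) univ := by
    refine ⟨(h.arg.continuous.comp (continuous_add_const T)).continuousOn, fun s _ => ?_⟩
    obtain ⟨r, hr, e⟩ := h.arg.2 (s + T) (mem_univ _)
    refine ⟨r, hr, ?_⟩
    simp only [hp s] at e
    exact e
  have hc : Continuous fun s => θ (s + T) - θ s :=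
    (h.arg.continuous.comp (continuous_add_const T)).sub h.arg.continuous
  have h0 : θ (0 + T) - θ 0 ≤ 2 * Real.pi := by rwa [zero_add]
  rcases argument_compare h.mem h.lin hv h.arg hη with ⟨-, hs⟩ | hs
  · rw [const_of_sin_eq_zero hc hs t 0]; exact h0
  · by_contra! hlt
    obtain ⟨x, hx⟩ := mem_range_of_exists_le_of_exists_ge hc ⟨0, h0⟩ ⟨t, hlt.le⟩
    exact hs x (by simp only at hx; rw [hx, Real.sin_two_pi])

end RotatingSolution

/-! ### Transverse solutions make more than one turn in a period -/

/-- `u` has at most one vertical instant in the open interval, and this one is simple. -/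
def AtMostOneZero (w u : ℝ → R4) (a b : ℝ) : Prop :=
  (∀ t ∈ Ioo a b, jac (w t) (u t) ≠ 0) ∨ ∃ t₁ ∈ Ioo a b, jac (w t₁) (u t₁) = 0 ∧
    tr2 (w t₁) (u t₁) ≠ 0 ∧ ∀ t ∈ Ioo a b, jac (w t) (u t) = 0 → t = t₁

namespace RotatingSolution

variable {w u : ℝ → R4} {θ : ℝ → ℝ}

theorem tr2_ne_zero_of_jac_eq_zero (h : RotatingSolution w u θ) {t : ℝ}
    (hy : 0 < w t 2 ^ 2 + w t 3 ^ 2) (hJ : jac (w t) (u t) = 0) : tr2 (w t) (u t) ≠ 0 := by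
  intro h2
  have hid : (g1 (w t) * w t 2 + g2 (w t) * w t 3) * tr2 (w t) (u t) -
      (w t 2 ^ 2 + w t 3 ^ 2) * tr1 (w t) (u t) = nsq (w t) * jac (w t) (u t) := by
    simp only [tr1, tr2, nsq, jac]
    linear_combination (w t 2 * g2 (w t) - w t 3 * g1 (w t)) * h.tangent t
  rw [h2, hJ] at hid
  have h1 : tr1 (w t) (u t) = 0 :=
    (mul_eq_zero.1 (show (w t 2 ^ 2 + w t 3 ^ 2) * _ = 0 by linarith)).resolve_left hy.ne'
  exact h.tr_ne_zero t (by simp only [tr, h1, h2]; rfl)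

/-- With one linear condition on the test field, the Riccati form decreases from one end of the
interval to the other. -/
theorem exists_decreasing_condition (h : RotatingSolution w u θ) {a b : ℝ} (hab : a < b)
    (hz : AtMostOneZero w u a b) : ∃ p : Fin 3 → ℝ, ∀ c : Fin 3 → ℝ, c ≠ 0 →
      p 0 * c 0 + p 1 * c 1 + p 2 * c 2 = 0 → ∀ La Lb : ℝ,
      Tendsto (fun s => riccati c (w s) (u s)) (𝓝[≠] a) (𝓝 La) →
      Tendsto (fun s => riccati c (w s) (u s)) (𝓝[≠] b) (𝓝 Lb) → Lb < La := by
  rcases hz with hz | ⟨t₁, ht, hJ, hJ', hz⟩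
  · exact ⟨0, fun c hc _ La Lb ha hb => lt_of_deriv_neg_Ioo hab
      (fun t ht => riccati_deriv_neg h.traj h.mem h.lin hc (hz t ht)) ha hb⟩
  · obtain ⟨p, hp⟩ := exists_condition hJ
    refine ⟨p, fun c hc hpc La Lb ha hb => ?_⟩
    have hlim := tendsto_riccati_of_simple h.traj h.lin c hJ hJ' (hp c hpc)
    have h1 := lt_of_deriv_neg_Ioo ht.1 (fun t ht' => riccati_deriv_neg h.traj h.mem h.lin hc
      fun h0 => ht'.2.ne (hz t ⟨ht'.1, ht'.2.trans ht.2⟩ h0)) ha hlim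
    have h2 := lt_of_deriv_neg_Ioo ht.2 (fun t ht' => riccati_deriv_neg h.traj h.mem h.lin hc
      fun h0 => ht'.1.ne' (hz t ⟨ht.1.trans ht'.1, ht'.2⟩ h0)) hlim hb
    exact h2.trans h1

/-- Two zeros of `jac`, or one degenerate zero, would raise `relAngle` to (k + 2)π inside the
interval. -/
theorem atMostOneZero (h : RotatingSolution w u θ) {a b : ℝ} {k : ℤ}
    (hk : k * Real.pi ≤ relAngle w θ a)
    (hb : ∀ s ∈ Ioo a b, jac (w s) (u s) = 0 → relAngle w θ s < (k + 2) * Real.pi) :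
    AtMostOneZero w u a b := by
  by_cases hz : ∀ t ∈ Ioo a b, jac (w t) (u t) ≠ 0
  · exact Or.inl hz
  push Not at hz
  obtain ⟨t₁, ht, hJ⟩ := hz
  have key : ∀ s ∈ Ioo a b, ∀ t ∈ Ioo a b, jac (w s) (u s) = 0 → jac (w t) (u t) = 0 →
      ¬ s < t := fun s hs t ht hJs hJt hst => by
    have h1 := (h.relAngle_at_zero hk hs.1 hJs).1
    have h2 := (h.relAngle_at_zero (k := k + 1) (by push_cast; exact h1) hst hJt).1
    push_cast at h2
    linarith [hb t ht hJt]
  refine Or.inr ⟨t₁, ht, hJ, fun h2 => ?_, fun t ht' hJ' => ?_⟩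
  · have := (h.relAngle_at_zero hk ht.1 hJ).2 h2
    linarith [hb t₁ ht hJ]
  · exact le_antisymm (not_lt.1 (key _ ht _ ht' hJ hJ')) (not_lt.1 (key _ ht' _ ht hJ' hJ))

/-- One condition on c serves the zero inside the interval; the other makes ξ tangent to the orbit
at its ends. The end limits then depend on w alone and agree by periodicity, against strict
decrease. -/
theorem not_atMostOneZero (h : RotatingSolution w u θ) {T : ℝ} (hT : 0 < T)
    (hp : Function.Periodic w T) {a : ℝ} (hy : 0 < w a 2 ^ 2 + w a 3 ^ 2) :
    ¬ AtMostOneZero w u a (a + T) := fun hz => by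
  obtain ⟨p, hpc⟩ := h.exists_decreasing_condition (by linarith) hz
  obtain ⟨c, hc, h1, h2⟩ := exists_field p
    ![-w a 3, w a 2, w a 2 * w a 1 - w a 3 * w a 0]
  have hF : fieldDet c (w a) = 0 := by
    simp at h2
    simp only [fieldDet, xi1, xi2]; linarith
  have la := tendsto_riccati_of_tangent h.traj h.lin c hy hF (h.tr2_ne_zero_of_jac_eq_zero hy)
  have lb := tendsto_riccati_of_tangent (t := a + T) h.traj h.lin c (by rwa [hp a])
    (by rwa [hp a]) (h.tr2_ne_zero_of_jac_eq_zero (by rwa [hp a]))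
  rw [hp a] at lb
  exact lt_irrefl _ (hpc c hc h1 _ _ la lb)

/-- After an instant with vanishing velocity there is a vertical instant within the period. -/
theorem exists_zero_of_brake (h : RotatingSolution w u θ) {T : ℝ} (hT : 0 < T)
    (hp : Function.Periodic w T) {a : ℝ} (h2 : w a 2 = 0) (h3 : w a 3 = 0) :
    ∃ t ∈ Ioo a (a + T), jac (w t) (u t) = 0 := by
  by_contra! hz
  -- The field is a homothety centred at the point of zero velocity, so the Riccati form tends to 0
  -- at both ends.
  obtain ⟨c, hc, h1, h2'⟩ := exists_field ![1, 0, w a 0] ![0, 1, w a 1]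
  have hx1 : xi1 c (w a) = 0 := by simp at h1; simp only [xi1]; linarith
  have hx2 : xi2 c (w a) = 0 := by simp at h2'; simp only [xi2]; linarith
  have la := tendsto_riccati_of_field_zero h.traj h.mem h.lin c h2 h3 hx1 hx2 (h.tr_ne_zero a)
  have lb := tendsto_riccati_of_field_zero (t := a + T) h.traj h.mem h.lin c (by rwa [hp a])
    (by rwa [hp a]) (by rwa [hp a]) (by rwa [hp a]) (h.tr_ne_zero _)
  exact lt_irrefl _ (lt_of_deriv_neg_Ioo (by linarith)
    (fun t ht => riccati_deriv_neg h.traj h.mem h.lin hc (hz t ht)) la lb)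

theorem cot_le {x y : ℝ} (hy : 0 < y) (hyx : y ≤ x) (hx : x < Real.pi) :
    Real.cos x / Real.sin x ≤ Real.cos y / Real.sin y := by
  have h1 := Real.sin_pos_of_pos_of_lt_pi hy (by linarith)
  have h2 := Real.sin_pos_of_pos_of_lt_pi (hy.trans_le hyx) hx
  rw [div_le_div_iff₀ h2 h1]
  have := Real.sin_nonneg_of_nonneg_of_le_pi (x := x - y) (by linarith) (by linarith)
  rw [Real.sin_sub] at this
  linarith

theorem cot_sub_int_mul_pi (x : ℝ) (k : ℤ) : Real.cos (x - k * Real.pi) /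
    Real.sin (x - k * Real.pi) = Real.cos x / Real.sin x := by
  rw [Real.sin_sub_int_mul_pi, Real.cos_sub_int_mul_pi]
  exact mul_div_mul_left _ _ (zpow_ne_zero _ (by norm_num))

theorem tr2_eq_zero_iff (h : RotatingSolution w u θ) (t : ℝ) :
    tr2 (w t) (u t) = 0 ↔ Real.sin (θ t) = 0 := by
  obtain ⟨r, hr, -, e⟩ := h.polar t
  rw [e, mul_eq_zero, or_iff_right hr.ne']

/-- If the turn is at most 2π, there is exactly one vertical instant inside the period. With ξ
orthogonal to g at the ends, the end values of the Riccati form are the same nonnegative factor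
times cot θ. Strict decrease would force cot θ(a + T) < cot θ(a), whereas a turn of at most 2π that
has passed two multiples of π gives the reverse inequality. -/
theorem no_brake (h : RotatingSolution w u θ) {T : ℝ} (hT : 0 < T)
    (hp : Function.Periodic w T) {a : ℝ} (hle : θ (a + T) - θ a ≤ 2 * Real.pi)
    (h2 : w a 2 = 0) (h3 : w a 3 = 0) : False := by
  have hpi := Real.pi_pos
  have ea : relAngle w θ a = θ a := by rw [relAngle, arg_vert_of_brake h2 h3, sub_zero]
  have h2' : w (a + T) 2 = 0 := by rwa [hp a]
  have h3' : w (a + T) 3 = 0 := by rwa [hp a]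
  have eb : relAngle w θ (a + T) = θ (a + T) := by
    rw [relAngle, arg_vert_of_brake h2' h3', sub_zero]
  have hJb : jac (w (a + T)) (u (a + T)) = 0 := by simp [jac, h2', h3']
  set k : ℤ := ⌊θ a / Real.pi⌋ with hkdef
  have hk : k * Real.pi ≤ θ a := by rw [← le_div_iff₀ hpi]; exact Int.floor_le _
  have hk' : θ a < (k + 1) * Real.pi := by rw [← div_lt_iff₀ hpi]; exact Int.lt_floor_add_one _
  -- The end a + T is itself a zero of `jac`, so reaching (k + 2)π earlier would force θ(a + T) ≥ (k
  -- + 3)π > θ(a) + 2π.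
  have hb : ∀ s ∈ Ioo a (a + T), jac (w s) (u s) = 0 → relAngle w θ s < (k + 2) * Real.pi :=
    fun s hs _ => by
      by_contra! hc
      have := (h.relAngle_at_zero (k := k + 2) (by push_cast; exact hc) hs.2 hJb).1
      push_cast at this
      rw [eb] at this
      linarith
  have hz := h.atMostOneZero (by rwa [ea]) hb
  obtain ⟨t₁, ht, hJ⟩ := h.exists_zero_of_brake hT hp h2 h3
  have h1 := (h.relAngle_at_zero (k := k) (by rwa [ea]) ht.1 hJ).1
  have h4 := h.relAngle_at_zero (k := k + 1) (by push_cast; exact h1) ht.2 hJb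
  push_cast at h4
  rw [eb] at h4
  have hsb : tr2 (w (a + T)) (u (a + T)) ≠ 0 := fun h0 => by
    have := h4.2 h0
    linarith
  have hsb' : Real.sin (θ (a + T)) ≠ 0 := fun h0 => hsb ((h.tr2_eq_zero_iff _).2 h0)
  have hltb : (k + 2) * Real.pi < θ (a + T) := by
    refine lt_of_le_of_ne (by linarith [h4.1]) fun heq => hsb' ?_
    have := Real.sin_int_mul_pi (k + 2)
    push_cast at this
    rw [← heq, this]
  have hsa : tr2 (w a) (u a) ≠ 0 := fun h0 => by
    rw [h.tr2_eq_zero_iff] at h0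
    obtain ⟨n, hn⟩ := Real.sin_eq_zero_iff.1 h0
    rw [← hn] at hk hk'
    have i1 : (n : ℝ) < k + 1 := lt_of_mul_lt_mul_right hk' hpi.le
    have i2 : n < k + 1 := by exact_mod_cast i1
    have i3 : (n : ℝ) ≤ k := by exact_mod_cast Int.lt_add_one_iff.1 i2
    have := mul_le_mul_of_nonneg_right i3 hpi.le
    linarith
  obtain ⟨p, hpc⟩ := h.exists_decreasing_condition (by linarith) hz
  obtain ⟨c, hc, c1, c2⟩ := exists_field p
    ![g1 (w a), g2 (w a), g1 (w a) * w a 0 + g2 (w a) * w a 1]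
  have hg : g1 (w a) * xi1 c (w a) + g2 (w a) * xi2 c (w a) = 0 := by
    simp at c2
    simp only [xi1, xi2]; linarith
  have la := tendsto_riccati_of_brake h.traj h.mem h.lin c h2 h3 hg hsa
  have lb := tendsto_riccati_of_brake (t := a + T) h.traj h.mem h.lin c h2' h3'
    (by rwa [hp a]) hsb
  have hlt := hpc c hc c1 _ _ la lb
  have hcot : ∀ t, tr1 (w t) (u t) / tr2 (w t) (u t) = Real.cos (θ t) / Real.sin (θ t) :=
    fun t => by
      obtain ⟨r, hr, e1, e2⟩ := h.polar t
      rw [e1, e2, mul_div_mul_left _ _ hr.ne']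
  rw [hcot, hcot, hp a] at hlt
  have hlt' := lt_of_mul_lt_mul_left hlt (by positivity)
  -- Both angles are reduced to (0, π) by different multiples of π; the bound on the turn then
  -- orders them.
  rw [← cot_sub_int_mul_pi (θ a) k, ← cot_sub_int_mul_pi (θ (a + T)) (k + 2)] at hlt'
  push_cast at hlt'
  exact absurd hlt' (not_lt.2 (cot_le (by linarith) (by linarith) (by linarith)))

/-- Transverse linearized solutions make more than one turn during a period. -/
theorem two_pi_lt (h : RotatingSolution w u θ) {T : ℝ} (hT : 0 < T)
    (hp : Function.Periodic w T) : 2 * Real.pi < θ T - θ 0 := by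
  by_contra! hle
  have hturn := h.turn_le hp hle
  have hy : ∀ a, 0 < w a 2 ^ 2 + w a 3 ^ 2 := fun a =>
    (momentum_cases (w a)).resolve_left fun hb => h.no_brake hT hp (hturn a) hb.1 hb.2
  by_cases hz : ∃ a, jac (w a) (u a) = 0
  · obtain ⟨a, hJ⟩ := hz
    obtain ⟨k, hk⟩ := Real.sin_eq_zero_iff.1 ((h.sin_relAngle_eq_zero_iff (hy a)).2 hJ)
    -- Starting at a zero of `jac`, reaching (k + 2)π before time a + T would give a turn of more
    -- than 2π: `vert` is periodic, so `relAngle` and θ gain the same amount over a period.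
    refine h.not_atMostOneZero hT hp (hy a) (h.atMostOneZero hk.le fun s hs _ => ?_)
    by_contra! hc
    have := h.relAngle_gt (k := k + 2) (by push_cast; exact hc) hs.2
    push_cast at this
    have ht := hturn a
    rw [relAngle, hp a] at this
    rw [relAngle] at hk
    linarith
  · push Not at hz
    exact h.not_atMostOneZero hT hp (hy 0) (Or.inl fun t _ => hz t)

end RotatingSolution

theorem dynamicallyConvex : DynamicallyConvex H (S \ saddleCenters) := by
  rintro w T ⟨hT, hw, hp, -⟩ hwS
  obtain ⟨a, b, hab, hlen, hI⟩ := rotationSet_eq_Icc hT hw hp hwS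
  refine index_of_Icc hab hlen ?_ hI
  -- The minimum of the rotation interval is attained, so the strict bound passes to it.
  obtain ⟨u, θ, hu, hθ, ha⟩ : a ∈ rotationSet H w T := hI ▸ left_mem_Icc.2 hab
  rw [isContinuousArgumentOn_transverse_iff fun t _ => nsq_pos (hwS t)] at hθ
  rw [ha, one_lt_div Real.two_pi_pos]
  exact RotatingSolution.two_pi_lt ⟨hw, hwS, hu, hθ⟩ hT hp

end HenonHeiles

end

theorem mainTheorem4 :
    HenonHeiles.DynamicallyConvex HenonHeiles.H (HenonHeiles.S \ HenonHeiles.saddleCenters) ∧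
    HenonHeiles.QuaternionFramePositive HenonHeiles.H
      (HenonHeiles.S \ HenonHeiles.saddleCenters) :=
  ⟨HenonHeiles.dynamicallyConvex, HenonHeiles.quaternionFramePositive⟩
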